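/- **Theorem (Effect of the underestimation policy).** *Setting.* There are $U\ge 1$ users; user $u$ has an unknown preference vector $\theta_u\in\mathbb R^d$, $d\ge1$, with $\|\theta_u\|_2\le 1$, and a dataset of $N_u\ge 1$ pairs $(a_u^i,r_u^i)$, $i=1,\dots,N_u$. Let $\rho$ be a probability distribution on the closed unit ball of $\mathbb R^d$ such that $\mathbb E_{a\sim\rho}[aa^\top]$ has minimum eigenvalue $\lambda_a>0$ and, for some $\sigma>0$ and every unit vector $x$, the variable $(x^\top a)^2$, $a\sim\rho$, is sub-Gaussian about its mean with variance parameter $\sigma^2$ (that is, $\mathbb E\,e^{t((x^\top a)^2-\mathbb E(x^\top a)^2)}\le e^{\sigma^2t^2/2}$ for all $t\in\mathbb R$). In round $i$ of user $u$, a candidate set of at most $S$ actions is drawn independently from $\rho$, independently of the earlier rounds of user $u$; the action $a_u^i$ is selected from it by an arbitrary, possibly randomised and history-dependent rule; and, given the earlier rounds of user $u$, the current candidates and $a_u^i$, the reward $r_u^i$ is drawn from a distribution $R_u(a_u^i)$ which has mean $\langle\theta_u,a_u^i\rangle$ and is 1-sub-Gaussian about it. Put $\tilde\lambda_a=\int_0^{\lambda_a}\bigl(1-e^{-(\lambda_a-x)^2/(2\sigma^2)}\bigr)^S\,dx$.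 *Algorithm.* Let $\alpha\ge 1$, $\lambda>0$ and $\delta\in(0,1)$ satisfy $$\lambda\le d\log\Bigl(1+\frac{\min_uN_u}{\lambda d}\Bigr)+2\log\frac{2U}{\delta},\qquad \delta\le\frac{2U}{1+\max_uN_u/(\lambda d)} .$$ Put $$M_u=\lambda I+\sum_{i=1}^{N_u}a_u^i(a_u^i)^\top,\qquad \hat\theta_u=M_u^{-1}\sum_{i=1}^{N_u}r_u^ia_u^i,\qquad \mathrm{CI}_u=\frac{\sqrt{d\log(1+\frac{N_u}{\lambda d})+2\log\frac{2U}{\delta}}+\sqrt\lambda}{\sqrt{\tilde\lambda_aN_u/2}},$$ $$N_{\min}=\frac{16}{\tilde\lambda_a^2}\log\frac{8Ud}{\tilde\lambda_a^2\delta},\qquad \Gamma(u,v)=\|\hat\theta_u-\hat\theta_v\|_2-\alpha(\mathrm{CI}_u+\mathrm{CI}_v),\qquad M(u)=\{v\ne u:\Gamma(u,v)>0\}.$$ For $g\ge0$ connect distinct users $u,v$ if $\|\hat\theta_u-\hat\theta_v\|_2<g-\alpha(\mathrm{CI}_u+\mathrm{CI}_v)$ and $\min\{N_u,N_v\}\ge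 N_{\min}$, and let $\mathcal W_g(u)$ be the set of neighbours $v$ of $u$ in this graph with $\theta_v\ne\theta_u$. *Claim.* Fix a user $u_{\rm test}$ and choose $\hat\gamma$ by the underestimation policy: $\hat\gamma=\min_{v\in M(u_{\rm test})}\Gamma(u_{\rm test},v)$ if $M(u_{\rm test})\neq\emptyset$, and $\hat\gamma=0$ otherwise. Then, with probability at least $1-\delta$, every $v\in\mathcal W_{\hat\gamma}(u_{\rm test})$ satisfies $$\frac1{\sqrt{N_{u_{\rm test}}}}+\frac1{\sqrt{N_v}}\ \ge\ \alpha_w'\,\|\theta_{u_{\rm test}}-\theta_v\|_2,\qquad \alpha_w'=\frac{\sqrt{\tilde\lambda_a}}{4(\alpha+1)\sqrt{\log(2U/\delta)\,\max\{2,d\}}}.$$ -/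

import Mathlib

open MeasureTheory ProbabilityTheory
open scoped NNReal ENNReal Matrix

namespace OffClusBand

/-- `ℝᵈ` with the Euclidean norm. -/
abbrev Vec (d : ℕ) : Type := EuclideanSpace ℝ (Fin d)

/-- An offline dataset: for each user `u`, the `N u` observed (action, reward) pairs. -/
abbrev Dataset (ι : Type*) (N : ι → ℕ) (d : ℕ) : Type _ := (u : ι) → Fin (N u) → Vec d × ℝ

/-- The numerical parameters used by the algorithm: `α`, `λ`, `δ`, and the smoothed regularity
parameter `lamT`, which is known to the algorithm. -/
structure Params where
  α : ℝ
  lam : ℝ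
  δ : ℝ
  lamT : ℝ

section Model

/-- The matrix `E[a aᵀ]`, for `a ∼ ρ`. -/
noncomputable def secondMoment {d : ℕ} (ρ : Measure (Vec d)) : Matrix (Fin d) (Fin d) ℝ :=
  Matrix.of fun i j => ∫ a, a i * a j ∂ρ

/-- Regularity of the action distribution: `ρ` is a distribution on the closed unit ball, `E[a aᵀ]`
has least eigenvalue `lamA > 0`, and `(xᵀa)²` is sub-Gaussian with variance parameter `σ²` for every
unit vector `x`. -/
structure ActionRegularity {d : ℕ} (ρ : Measure (Vec d)) (lamA σ : ℝ) : Prop where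
  isProb : IsProbabilityMeasure ρ
  norm_le_one : ∀ᵐ a ∂ρ, ‖a‖ ≤ 1
  isLeast_eigenvalue :
    IsLeast {μ : ℝ | Module.End.HasEigenvalue (Matrix.toLin' (secondMoment ρ)) μ} lamA
  lamA_pos : 0 < lamA
  σ_pos : 0 < σ
  subgaussian : ∀ x : Vec d, ‖x‖ = 1 →
    HasSubgaussianMGF (fun a => (inner ℝ x a) ^ 2 - ∫ b, (inner ℝ x b) ^ 2 ∂ρ)
      (⟨σ ^ 2, sq_nonneg σ⟩ : ℝ≥0) ρ

/-- The smoothed regularity parameter `∫₀^{lamA} (1 - exp (-(lamA - x)² / (2σ²)))^S dx`. -/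
noncomputable def smoothedParam (lamA σ : ℝ) (S : ℕ) : ℝ :=
  ∫ x in (0 : ℝ)..lamA, (1 - Real.exp (-(lamA - x) ^ 2 / (2 * σ ^ 2))) ^ S

/-- `R u a` is the reward distribution of user `u` for action `a`: it has mean `⟨θ u, a⟩` and is
1-sub-Gaussian around its mean, for every action `a` of the unit ball. -/
structure RewardModel {ι : Type*} {d : ℕ} (θ : ι → Vec d) (R : ι → Kernel (Vec d) ℝ) : Prop where
  isMarkov : ∀ u, IsMarkovKernel (R u)
  mean_eq : ∀ u a, ‖a‖ ≤ 1 → ∫ r, r ∂(R u a) = inner ℝ (θ u) a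
  subgaussian : ∀ u a, ‖a‖ ≤ 1 → HasSubgaussianMGF (fun r : ℝ => r - inner ℝ (θ u) a) 1 (R u a)

variable {Ω : Type*} {ι : Type*} {N : ι → ℕ} {d : ℕ}

/-- Everything observed for user `u` before round `i`: the earlier candidates, actions, rewards. -/
@[reducible] def history (K : (u : ι) → Fin (N u) → ℕ)
    (X : (u : ι) → (i : Fin (N u)) → Fin (K u i) → Ω → Vec d)
    (a : (u : ι) → Fin (N u) → Ω → Vec d) (r : (u : ι) → Fin (N u) → Ω → ℝ)
    (u : ι) (i : Fin (N u)) : MeasurableSpace Ω :=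
  ⨆ j : Fin (N u), ⨆ _ : j < i,
    (⨆ k, MeasurableSpace.comap (X u j k) inferInstance)
      ⊔ MeasurableSpace.comap (a u j) inferInstance ⊔ MeasurableSpace.comap (r u j) inferInstance

/-- The generation of the offline data. In round `i` of user `u` a fresh set of `K u i ≤ S`
candidates `X u i k` is drawn independently from `ρ`; the logging rule, which is arbitrary (and may
be randomised and depend on the past), picks `a u i` among them; finally the reward
`r u i` is drawn from `R u (a u i)`, i.e. this is its conditional distribution given the past, the
candidates and the chosen action. -/
structure IsOfflineData [MeasurableSpace Ω] (P : Measure Ω) (ρ : Measure (Vec d)) (S : ℕ)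
    (R : ι → Kernel (Vec d) ℝ) (K : (u : ι) → Fin (N u) → ℕ)
    (X : (u : ι) → (i : Fin (N u)) → Fin (K u i) → Ω → Vec d)
    (a : (u : ι) → Fin (N u) → Ω → Vec d) (r : (u : ι) → Fin (N u) → Ω → ℝ) : Prop where
  measurable_cand : ∀ u i k, Measurable (X u i k)
  measurable_action : ∀ u i, Measurable (a u i)
  measurable_reward : ∀ u i, Measurable (r u i)
  card_le : ∀ u i, K u i ≤ S
  cand_law : ∀ u i k, P.map (X u i k) = ρ
  cand_iIndep : ∀ u i, iIndepFun (fun k => X u i k) P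
  cand_fresh : ∀ u i,
    Indep (⨆ k, MeasurableSpace.comap (X u i k) inferInstance) (history K X a r u i) P
  action_mem : ∀ u i, ∀ᵐ ω ∂P, ∃ k, a u i ω = X u i k ω
  reward_law : ∀ u i, ∀ A : Set Ω,
    MeasurableSet[history K X a r u i ⊔ (⨆ k, MeasurableSpace.comap (X u i k) inferInstance)
      ⊔ MeasurableSpace.comap (a u i) inferInstance] A →
    ∀ B : Set ℝ, MeasurableSet B →
      P (A ∩ r u i ⁻¹' B) = ∫⁻ ω in A, R u (a u i ω) B ∂P

end Model

section Algorithm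

variable {ι : Type*} {N : ι → ℕ} {d : ℕ}

/-- `M_u = λ I + ∑ᵢ aᵢ aᵢᵀ`. -/
noncomputable def gram (lam : ℝ) (D : Dataset ι N d) (u : ι) : Matrix (Fin d) (Fin d) ℝ :=
  lam • (1 : Matrix (Fin d) (Fin d) ℝ)
    + ∑ i, Matrix.vecMulVec (D u i).1.ofLp (D u i).1.ofLp

/-- `b_u = ∑ᵢ rᵢ aᵢ`. -/
noncomputable def moment (D : Dataset ι N d) (u : ι) : Vec d :=
  ∑ i, (D u i).2 • (D u i).1

/-- The ridge estimate `M_u⁻¹ b_u`. -/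
noncomputable def ridge (lam : ℝ) (D : Dataset ι N d) (u : ι) : Vec d :=
  WithLp.toLp 2 ((gram lam D u)⁻¹ *ᵥ (moment D u).ofLp)

/-- The confidence width `CI_u` of a user with `n` samples, when there are `U` users. -/
noncomputable def ciWidth (p : Params) (U d n : ℕ) : ℝ :=
  (√(d * Real.log (1 + n / (p.lam * d)) + 2 * Real.log (2 * U / p.δ)) + √p.lam)
    / √(p.lamT * n / 2)

/-- The minimal number of samples of a user that can be connected. -/
noncomputable def nMin (p : Params) (U d : ℕ) : ℝ :=
  16 / p.lamT ^ 2 * Real.log (8 * U * d / (p.lamT ^ 2 * p.δ))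

variable [Fintype ι]

/-- The statistic `Γ(u, v)`. -/
noncomputable def lowerGap (p : Params) (D : Dataset ι N d) (u v : ι) : ℝ :=
  ‖ridge p.lam D u - ridge p.lam D v‖
    - p.α * (ciWidth p (Fintype.card ι) d (N u) + ciWidth p (Fintype.card ι) d (N v))

open Classical in
/-- `M(u)`: the users `v ≠ u` with `Γ(u, v) > 0`. -/
noncomputable def separatedUsers (p : Params) (D : Dataset ι N d) (u : ι) : Finset ι :=
  Finset.univ.filter fun v => v ≠ u ∧ 0 < lowerGap p D u v

open Classical in
/-- The underestimation policy: the least value of `Γ(u, ·)` on `M(u)`, or `0` if `M(u)` is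
empty. -/
noncomputable def underestimate (p : Params) (D : Dataset ι N d) (u : ι) : ℝ :=
  if h : (separatedUsers p D u).Nonempty then
    (separatedUsers p D u).inf' h (lowerGap p D u)
  else 0

/-- The graph built in the cluster phase with threshold `g`. -/
noncomputable def connGraph (p : Params) (D : Dataset ι N d) (g : ℝ) : SimpleGraph ι where
  Adj u v := u ≠ v ∧
    ‖ridge p.lam D u - ridge p.lam D v‖
      < g - p.α * (ciWidth p (Fintype.card ι) d (N u) + ciWidth p (Fintype.card ι) d (N v)) ∧
    nMin p (Fintype.card ι) d ≤ min (N u : ℝ) (N v : ℝ)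
  symm := ⟨fun u v h => ⟨h.1.symm, by
    rw [norm_sub_rev, add_comm (ciWidth p (Fintype.card ι) d (N v)), min_comm]; exact h.2⟩⟩
  loopless := ⟨fun _ h => h.1 rfl⟩

/-- `u` together with its neighbours in the graph with threshold `g`. -/
def neighbors (p : Params) (D : Dataset ι N d) (g : ℝ) (u : ι) : Set ι :=
  {u} ∪ {v | (connGraph p D g).Adj u v}

/-- The heterogeneous neighbours of `u`: those with a different preference vector. -/
def heteroNeighbors (θ : ι → Vec d) (p : Params) (D : Dataset ι N d) (g : ℝ) (u : ι) : Set ι :=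
  {v | v ∈ neighbors p D g u ∧ θ u ≠ θ v}

end Algorithm

end OffClusBand

/-!
With probability at least `1 - δ / U` a user `u` with at least `N_min` samples satisfies
`‖θ̂_u - θ_u‖ ≤ CI_u`. Indeed `h = θ̂_u - θ_u` solves the normal equations, so its quadratic form
`hᵀ M_u h` is controlled by the noise and by the bias of the regularization; it then suffices that
the noise is small and that `M_u` is large.

* Noise: the exponential of `⟪x, ∑ᵢ noiseᵢ aᵢ⟫ - ∑ᵢ ⟪x, aᵢ⟫² / 2` has mean at most `1` for each
  `x`, and integrating it against a Gaussian weight in `x` (the method of mixtures) gives a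
  self-normalized bound in all directions at once.
* Exploration: whatever the logging rule picks, `⟪x, a⟫²` is at least the minimum of `⟪x, ·⟫²` over
  the fresh candidates, which has mean at least `λ̃_a` given the past. This yields a lower-tail
  bound in each fixed direction, and averaging it over the ball makes it uniform, because a poorly
  explored unit vector is surrounded by a small ball of poorly explored vectors.

On the intersection of these events over all users, the policy never exceeds a positive `Γ(u, v)`,
so users that it connects have `Γ(u, v) ≤ 0`. By the triangle inequality
`‖θ_u - θ_v‖ ≤ (α + 1) (CI_u + CI_v)`, and the conditions on `λ` and `δ` bound `CI_u` by a multiple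
of `1 / √N_u`.
-/

namespace OffClusBand

section Probability

variable {Ω 𝓧 𝓨 : Type*} [MeasurableSpace Ω] [MeasurableSpace 𝓧] [MeasurableSpace 𝓨]
  {P : Measure Ω}

lemma lintegral_prod_le_of_forall_weight {n : ℕ} (H : Fin n → MeasurableSpace Ω)
    (f : Fin n → Ω → ℝ≥0∞) (c : Fin n → ℝ≥0∞)
    (hmeas : ∀ i j, j < i → Measurable[H i] (f j))
    (hstep : ∀ i (W : Ω → ℝ≥0∞), Measurable[H i] W →
      ∫⁻ ω, W ω * f i ω ∂P ≤ c i * ∫⁻ ω, W ω ∂P) :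
    ∫⁻ ω, ∏ i, f i ω ∂P ≤ (∏ i, c i) * P Set.univ := by
  induction n with
  | zero => simp
  | succ n ih =>
    have hpast : ∫⁻ ω, ∏ i : Fin n, f i.castSucc ω ∂P
        ≤ (∏ i : Fin n, c i.castSucc) * P Set.univ :=
      ih (fun i => H i.castSucc) _ _ (fun i j hji => hmeas _ _ hji) fun i => hstep i.castSucc
    have hmeas_past : Measurable[H (Fin.last n)] fun ω => ∏ i : Fin n, f i.castSucc ω :=
      Finset.measurable_fun_prod _ fun i _ => hmeas _ _ i.castSucc_lt_last
    simp only [Fin.prod_univ_castSucc]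
    calc ∫⁻ ω, (∏ i : Fin n, f i.castSucc ω) * f (Fin.last n) ω ∂P
        ≤ c (Fin.last n) * ∫⁻ ω, ∏ i : Fin n, f i.castSucc ω ∂P := hstep _ _ hmeas_past
      _ ≤ c (Fin.last n) * ((∏ i : Fin n, c i.castSucc) * P Set.univ) := by gcongr
      _ = (∏ i : Fin n, c i.castSucc) * c (Fin.last n) * P Set.univ := by ring

lemma ofReal_integral_le_lintegral_ofReal (μ : Measure 𝓧) (f : 𝓧 → ℝ) :
    ENNReal.ofReal (∫ x, f x ∂μ) ≤ ∫⁻ x, ENNReal.ofReal (f x) ∂μ := by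
  by_cases hf : Integrable f μ
  · rw [integral_eq_lintegral_pos_part_sub_lintegral_neg_part hf]
    exact (ENNReal.ofReal_le_ofReal (sub_le_self _ ENNReal.toReal_nonneg)).trans
      ENNReal.ofReal_toReal_le
  · simp [integral_undef hf]

lemma mul_measure_le_lintegral_of_mixture [SFinite P] {μ : Measure 𝓧} [SFinite μ]
    {Φ : Ω → 𝓧 → ℝ≥0∞} (hΦ : Measurable (Function.uncurry Φ)) {m : 𝓧 → ℝ≥0∞}
    (hm : ∀ᵐ x ∂μ, ∫⁻ ω, Φ ω x ∂P ≤ m x) {B : Set Ω} {c : ℝ≥0∞}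
    (hB : ∀ᵐ ω ∂P, ω ∈ B → c ≤ ∫⁻ x, Φ ω x ∂μ) :
    c * P B ≤ ∫⁻ x, m x ∂μ :=
  calc c * P B ≤ c * P {ω | c ≤ ∫⁻ x, Φ ω x ∂μ} := by gcongr 1; exact measure_mono_ae hB
    _ ≤ ∫⁻ ω, ∫⁻ x, Φ ω x ∂μ ∂P := mul_meas_ge_le_lintegral hΦ.lintegral_prod_right' c
    _ = ∫⁻ x, ∫⁻ ω, Φ ω x ∂P ∂μ := lintegral_lintegral_swap hΦ.aemeasurable
    _ ≤ ∫⁻ x, m x ∂μ := lintegral_mono_ae hm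

lemma setLIntegral_pow_card_le_lintegral_iInf {κ : Type*} [Fintype κ] [Nonempty κ]
    {Y : κ → Ω → ℝ} (hY : ∀ j, Measurable (Y j)) (hY_nonneg : ∀ j ω, 0 ≤ Y j ω)
    (hindep : iIndepFun Y P) {s : Set ℝ} (hs : MeasurableSet s) (hs_pos : s ⊆ Set.Ioi 0)
    {q : ℝ → ℝ≥0∞} (hq : ∀ t ∈ s, ∀ j, q t ≤ P {ω | t < Y j ω}) :
    ∫⁻ t in s, q t ^ Fintype.card κ ≤ ∫⁻ ω, ENNReal.ofReal (⨅ j, Y j ω) ∂P := by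
  have htail (t : ℝ) : P {ω | t < ⨅ j, Y j ω} = ∏ j, P {ω | t < Y j ω} := by
    have hset : {ω | t < ⨅ j, Y j ω} = ⋂ j ∈ Finset.univ, Y j ⁻¹' Set.Ioi t := by
      ext ω
      simp [iInf, (Set.finite_range fun j => Y j ω).lt_csInf_iff (Set.range_nonempty _)]
    rw [hset, hindep.measure_inter_preimage_eq_mul _ fun j _ => measurableSet_Ioi]
    rfl
  calc ∫⁻ t in s, q t ^ Fintype.card κ
      ≤ ∫⁻ t in s, P {ω | t < ⨅ j, Y j ω} := by
        refine setLIntegral_mono' hs fun t ht => ?_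
        rw [htail, ← Finset.card_univ, ← Finset.prod_const]
        exact Finset.prod_le_prod' fun j _ => hq t ht j
    _ ≤ ∫⁻ t in Set.Ioi 0, P {ω | t < ⨅ j, Y j ω} := lintegral_mono_set hs_pos
    _ = ∫⁻ ω, ENNReal.ofReal (⨅ j, Y j ω) ∂P :=
        (lintegral_eq_lintegral_meas_lt P
          (ae_of_all _ fun ω => Real.iInf_nonneg fun j => hY_nonneg j ω)
          (Measurable.iInf hY).aemeasurable).symm

lemma exp_neg_mul_le_one_sub_mul {s z : ℝ} (hs : 0 ≤ s) (hz₀ : 0 ≤ z) (hz₁ : z ≤ 1) :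
    Real.exp (-(s * z)) ≤ 1 - (s - s ^ 2 / 2) * z := by
  have hsz : 0 ≤ s * z := mul_nonneg hs hz₀
  have hquad : Real.exp (-(s * z)) ≤ 1 - s * z + (s * z) ^ 2 / 2 := by
    rw [Real.exp_neg]
    refine (inv_anti₀ (by positivity) (Real.quadratic_le_exp_of_nonneg hsz)).trans ?_
    rw [inv_le_iff_one_le_mul₀ (by positivity)]
    nlinarith [sq_nonneg ((s * z) ^ 2)]
  have hz_sq : z ^ 2 ≤ z := by nlinarith
  nlinarith [mul_le_mul_of_nonneg_left hz_sq (sq_nonneg s)]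

lemma lintegral_exp_neg_mul_le [IsProbabilityMeasure P] {Z : Ω → ℝ} (hZ : Measurable Z)
    (hZ₀ : ∀ᵐ ω ∂P, 0 ≤ Z ω) (hZ₁ : ∀ᵐ ω ∂P, Z ω ≤ 1) {s t : ℝ} (hs : s ∈ Set.Icc 0 2)
    (ht : ENNReal.ofReal t ≤ ∫⁻ ω, ENNReal.ofReal (Z ω) ∂P) :
    ∫⁻ ω, ENNReal.ofReal (Real.exp (-(s * Z ω))) ∂P
      ≤ ENNReal.ofReal (Real.exp (-((s - s ^ 2 / 2) * t))) := by
  have hc : 0 ≤ s - s ^ 2 / 2 := by nlinarith [hs.1, hs.2]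
  have hint : Integrable Z P := Integrable.of_bound hZ.aestronglyMeasurable 1 (by
    filter_upwards [hZ₀, hZ₁] with ω h₀ h₁
    rwa [Real.norm_eq_abs, abs_of_nonneg h₀])
  have hint_exp : Integrable (fun ω => Real.exp (-(s * Z ω))) P :=
    Integrable.of_bound (by fun_prop) 1 (by
      filter_upwards [hZ₀] with ω h₀
      rw [Real.norm_eq_abs, Real.abs_exp, Real.exp_le_one_iff, neg_nonpos]
      exact mul_nonneg hs.1 h₀)
  have ht' : t ≤ ∫ ω, Z ω ∂P := by
    rwa [← ofReal_integral_eq_lintegral_ofReal hint hZ₀,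
      ENNReal.ofReal_le_ofReal_iff (integral_nonneg_of_ae hZ₀)] at ht
  rw [← ofReal_integral_eq_lintegral_ofReal hint_exp (ae_of_all _ fun ω => Real.exp_nonneg _)]
  refine ENNReal.ofReal_le_ofReal ?_
  calc ∫ ω, Real.exp (-(s * Z ω)) ∂P
      ≤ ∫ ω, (1 - (s - s ^ 2 / 2) * Z ω) ∂P := by
        refine integral_mono_ae hint_exp ((integrable_const 1).sub (hint.const_mul _)) ?_
        filter_upwards [hZ₀, hZ₁] with ω h₀ h₁ using exp_neg_mul_le_one_sub_mul hs.1 h₀ h₁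
    _ = 1 - (s - s ^ 2 / 2) * ∫ ω, Z ω ∂P := by
        rw [integral_sub (integrable_const 1) (hint.const_mul _), integral_const_mul]
        simp
    _ ≤ 1 - (s - s ^ 2 / 2) * t := by gcongr
    _ ≤ Real.exp (-((s - s ^ 2 / 2) * t)) := Real.one_sub_le_exp_neg _

lemma hasCondDistrib_of_setLIntegral [IsFiniteMeasure P] {V : Ω → 𝓧} {Y : Ω → 𝓨}
    {κ : Kernel 𝓧 𝓨} [IsFiniteKernel κ] (hV : Measurable V) (hY : Measurable Y)
    (h : ∀ s t, MeasurableSet s → MeasurableSet t →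
      P (V ⁻¹' s ∩ Y ⁻¹' t) = ∫⁻ ω in V ⁻¹' s, κ (V ω) t ∂P) :
    HasCondDistrib Y V κ P where
  map_eq := by
    refine Measure.ext_prod fun {s t} hs ht => ?_
    rw [Measure.map_apply (hV.prodMk hY) (hs.prod ht), Measure.compProd_apply_prod hs ht,
      setLIntegral_map hs (κ.measurable_coe ht) hV, Set.mk_preimage_prod, h s t hs ht]

lemma lintegral_comp_of_hasCondDistrib [SFinite P] {V : Ω → 𝓧} {Y : Ω → 𝓨} {κ : Kernel 𝓧 𝓨}
    [IsSFiniteKernel κ] (h : HasCondDistrib Y V κ P) {f : 𝓧 × 𝓨 → ℝ≥0∞} (hf : Measurable f) :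
    ∫⁻ ω, f (V ω, Y ω) ∂P = ∫⁻ ω, ∫⁻ y, f (V ω, y) ∂κ (V ω) ∂P := by
  rw [HasLaw.lintegral_comp h hf.aemeasurable, Measure.lintegral_compProd hf,
    lintegral_map' (Measurable.lintegral_kernel_prod_right' hf).aemeasurable
      h.aemeasurable_fst]

lemma ofReal_one_sub_le_of_compl_subset_iUnion [IsProbabilityMeasure P] {ι : Type*} [Fintype ι]
    {G : Set Ω} {B : ι → Set Ω} {δ : ℝ} (hδ : 0 ≤ δ)
    (hB : ∀ u, P (B u) ≤ ENNReal.ofReal (δ / Fintype.card ι)) (hG : Gᶜ ⊆ ⋃ u, B u) :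
    ENNReal.ofReal (1 - δ) ≤ P G := by
  have hcompl : P Gᶜ ≤ ENNReal.ofReal δ :=
    calc P Gᶜ ≤ ∑ u, P (B u) := (measure_mono hG).trans (measure_iUnion_fintype_le P B)
      _ ≤ ∑ _u : ι, ENNReal.ofReal (δ / Fintype.card ι) := Finset.sum_le_sum fun u _ => hB u
      _ = ENNReal.ofReal (Fintype.card ι / Fintype.card ι * δ) := by
        rw [Finset.sum_const, Finset.card_univ, nsmul_eq_mul, ← ENNReal.ofReal_natCast,
          ← ENNReal.ofReal_mul (by positivity), mul_div_left_comm, mul_comm]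
      _ ≤ ENNReal.ofReal δ :=
        ENNReal.ofReal_le_ofReal (mul_le_of_le_one_left hδ (div_self_le_one _))
  rw [ENNReal.ofReal_sub _ hδ, ENNReal.ofReal_one, tsub_le_iff_right, ← measure_univ (μ := P)]
  exact (measure_univ_le_add_compl G).trans (by gcongr)

end Probability

section SecondMoment

open scoped MatrixOrder Matrix.Norms.L2Operator in
lemma mul_dotProduct_self_le_of_forall_hasEigenvalue {m : Type*} [Fintype m] [DecidableEq m]
    {M : Matrix m m ℝ} (hM : M.IsHermitian) {c : ℝ}
    (hc : ∀ μ, Module.End.HasEigenvalue (Matrix.toLin' M) μ → c ≤ μ) (x : m → ℝ) :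
    c * (x ⬝ᵥ x) ≤ x ⬝ᵥ (M *ᵥ x) := by
  have hle : algebraMap ℝ (Matrix m m ℝ) c ≤ M := by
    refine algebraMap_le_of_le_spectrum (ha := hM) fun {μ} hμ => hc μ ?_
    rwa [Module.End.hasEigenvalue_iff_mem_spectrum, Matrix.spectrum_toLin']
  simpa [Matrix.sub_mulVec, Algebra.algebraMap_eq_smul_one, Matrix.smul_mulVec, dotProduct_sub]
    using (Matrix.le_iff.1 hle).dotProduct_mulVec_nonneg x

variable {d : ℕ} {ρ : Measure (Vec d)} [IsFiniteMeasure ρ]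

lemma integrable_mul_coord (hρ : ∀ᵐ a ∂ρ, ‖a‖ ≤ 1) (i j : Fin d) :
    Integrable (fun a : Vec d => a i * a j) ρ := by
  refine Integrable.of_bound (by fun_prop) 1 ?_
  filter_upwards [hρ] with a ha
  rw [norm_mul]
  exact mul_le_one₀ ((PiLp.norm_apply_le a i).trans ha) (norm_nonneg _)
    ((PiLp.norm_apply_le a j).trans ha)

lemma integral_inner_sq_eq_dotProduct_secondMoment (hρ : ∀ᵐ a ∂ρ, ‖a‖ ≤ 1) (x : Vec d) :
    ∫ a, (inner ℝ x a) ^ 2 ∂ρ = x.ofLp ⬝ᵥ (secondMoment ρ *ᵥ x.ofLp) := by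
  have hexpand (a : Vec d) : (inner ℝ x a) ^ 2 = ∑ i, ∑ j, x i * x j * (a i * a j) := by
    rw [PiLp.inner_apply, sq, Finset.sum_mul_sum]
    refine Finset.sum_congr rfl fun i _ => Finset.sum_congr rfl fun j _ => ?_
    simp only [RCLike.inner_apply, conj_trivial]
    ring
  have hint (i j : Fin d) : Integrable (fun a : Vec d => x i * x j * (a i * a j)) ρ :=
    (integrable_mul_coord hρ i j).const_mul _
  simp_rw [hexpand]
  rw [integral_finsetSum _ fun i _ => integrable_finsetSum _ fun j _ => hint i j]
  simp only [dotProduct, Matrix.mulVec, secondMoment, Matrix.of_apply, Finset.mul_sum]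
  refine Finset.sum_congr rfl fun i _ => ?_
  rw [integral_finsetSum _ fun j _ => hint i j]
  refine Finset.sum_congr rfl fun j _ => ?_
  rw [integral_const_mul]
  ring

end SecondMoment

section SmoothedParam

variable {lamA σ : ℝ} {S : ℕ}

lemma smoothedParam_base_mem_Icc (lamA σ x : ℝ) :
    1 - Real.exp (-(lamA - x) ^ 2 / (2 * σ ^ 2)) ∈ Set.Icc (0 : ℝ) 1 := by
  have hexp : Real.exp (-(lamA - x) ^ 2 / (2 * σ ^ 2)) ≤ 1 :=
    Real.exp_le_one_iff.2 (div_nonpos_of_nonpos_of_nonneg (neg_nonpos.2 (sq_nonneg _))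
      (by positivity))
  exact ⟨sub_nonneg.2 hexp, sub_le_self _ (Real.exp_nonneg _)⟩

lemma smoothedParam_le (hlamA : 0 ≤ lamA) : smoothedParam lamA σ S ≤ lamA := by
  have hmono : smoothedParam lamA σ S ≤ ∫ _ in (0 : ℝ)..lamA, (1 : ℝ) :=
    intervalIntegral.integral_mono_on hlamA (Continuous.intervalIntegrable (by fun_prop) _ _)
      intervalIntegrable_const fun x _ =>
        pow_le_one₀ (smoothedParam_base_mem_Icc lamA σ x).1 (smoothedParam_base_mem_Icc lamA σ x).2
  simpa using hmono

lemma smoothedParam_pos (hlamA : 0 < lamA) (hσ : 0 < σ) : 0 < smoothedParam lamA σ S := by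
  refine intervalIntegral.intervalIntegral_pos_of_pos_on
    (Continuous.intervalIntegrable (by fun_prop) _ _) (fun x hx => pow_pos ?_ S) hlamA
  have hsq : 0 < (lamA - x) ^ 2 / (2 * σ ^ 2) := by
    have : 0 < lamA - x := sub_pos.2 hx.2
    positivity
  rw [sub_pos, Real.exp_lt_one_iff, neg_div]
  exact neg_lt_zero.2 hsq

lemma ofReal_smoothedParam (hlamA : 0 ≤ lamA) :
    ENNReal.ofReal (smoothedParam lamA σ S) = ∫⁻ t in Set.Ioc 0 lamA,
      ENNReal.ofReal (1 - Real.exp (-(lamA - t) ^ 2 / (2 * σ ^ 2))) ^ S := by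
  have hbase (t : ℝ) := (smoothedParam_base_mem_Icc lamA σ t).1
  have hint : IntervalIntegrable (fun t => (1 - Real.exp (-(lamA - t) ^ 2 / (2 * σ ^ 2))) ^ S)
      volume 0 lamA := Continuous.intervalIntegrable (by fun_prop) _ _
  rw [smoothedParam, intervalIntegral.integral_of_le hlamA,
    ofReal_integral_eq_lintegral_ofReal hint.1 (ae_of_all _ fun t => pow_nonneg (hbase t) S)]
  simp_rw [ENNReal.ofReal_pow (hbase _)]

end SmoothedParam

section ActionRegularity

variable {d : ℕ} {ρ : Measure (Vec d)} {lamA σ : ℝ}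

lemma ActionRegularity.lamA_mul_norm_sq_le_integral (hρ : ActionRegularity ρ lamA σ) (x : Vec d) :
    lamA * ‖x‖ ^ 2 ≤ ∫ a, (inner ℝ x a) ^ 2 ∂ρ := by
  have := hρ.isProb
  have hherm : (secondMoment ρ).IsHermitian := by
    ext i j
    simp [secondMoment, mul_comm]
  rw [integral_inner_sq_eq_dotProduct_secondMoment hρ.norm_le_one]
  convert mul_dotProduct_self_le_of_forall_hasEigenvalue hherm
    (fun μ hμ => hρ.isLeast_eigenvalue.2 hμ) x.ofLp using 2
  rw [EuclideanSpace.real_norm_sq_eq, dotProduct]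
  simp only [sq]

lemma ActionRegularity.dim_mul_lamA_le_one (hρ : ActionRegularity ρ lamA σ) : d * lamA ≤ 1 := by
  have := hρ.isProb
  set e := EuclideanSpace.basisFun (Fin d) ℝ
  have hint (i : Fin d) : Integrable (fun a : Vec d => (inner ℝ (e i) a) ^ 2) ρ := by
    simpa [e, sq, EuclideanSpace.inner_single_left] using integrable_mul_coord hρ.norm_le_one i i
  calc (d : ℝ) * lamA = ∑ i, lamA * ‖e i‖ ^ 2 := by simp
    _ ≤ ∑ i, ∫ a, (inner ℝ (e i) a) ^ 2 ∂ρ :=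
        Finset.sum_le_sum fun i _ => hρ.lamA_mul_norm_sq_le_integral (e i)
    _ = ∫ a, ∑ i, (inner ℝ (e i) a) ^ 2 ∂ρ := (integral_finsetSum _ fun i _ => hint i).symm
    _ ≤ ∫ _, (1 : ℝ) ∂ρ := by
        refine integral_mono_ae (integrable_finsetSum _ fun i _ => hint i)
          (integrable_const 1) ?_
        filter_upwards [hρ.norm_le_one] with a ha
        rw [e.sum_sq_inner_right]
        exact pow_le_one₀ (norm_nonneg _) ha
    _ = 1 := by simp

lemma ActionRegularity.le_measure_lt_inner_sq (hρ : ActionRegularity ρ lamA σ) {x : Vec d}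
    (hx : ‖x‖ = 1) {t : ℝ} (ht : t ≤ lamA) :
    ENNReal.ofReal (1 - Real.exp (-(lamA - t) ^ 2 / (2 * σ ^ 2)))
      ≤ ρ {a | t < (inner ℝ x a) ^ 2} := by
  have := hρ.isProb
  have hmean : lamA ≤ ∫ a, (inner ℝ x a) ^ 2 ∂ρ := by
    simpa [hx] using hρ.lamA_mul_norm_sq_le_integral x
  have hmeas : MeasurableSet {a : Vec d | t < (inner ℝ x a) ^ 2} :=
    measurableSet_lt measurable_const (by fun_prop)
  have htail : ρ.real {a | t < (inner ℝ x a) ^ 2}ᶜ ≤ Real.exp (-(lamA - t) ^ 2 / (2 * σ ^ 2)) := by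
    refine (measureReal_mono fun a ha => ?_).trans
      ((hρ.subgaussian x hx).neg.measure_ge_le (sub_nonneg.2 ht))
    simp only [Set.mem_compl_iff, Set.mem_ofPred_eq, not_lt, Pi.neg_apply] at ha ⊢
    linarith
  rw [probReal_compl_eq_one_sub hmeas] at htail
  exact (ENNReal.ofReal_le_iff_le_toReal (by finiteness)).2 (by
    rw [← measureReal_def]
    linarith)

variable {Ω κ : Type*} [MeasurableSpace Ω] {P : Measure Ω} [Fintype κ] [Nonempty κ] {S : ℕ}
  {Y : κ → Ω → Vec d}

lemma ActionRegularity.smoothedParam_le_lintegral_iInf_of_norm_eq_one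
    (hρ : ActionRegularity ρ lamA σ) (hκ : Fintype.card κ ≤ S) (hY : ∀ j, Measurable (Y j))
    (hlaw : ∀ j, P.map (Y j) = ρ) (hindep : iIndepFun Y P) {x : Vec d} (hx : ‖x‖ = 1) :
    ENNReal.ofReal (smoothedParam lamA σ S)
      ≤ ∫⁻ ω, ENNReal.ofReal (⨅ j, (inner ℝ x (Y j ω)) ^ 2) ∂P := by
  have hmeas_sq : Measurable fun a : Vec d => (inner ℝ x a) ^ 2 := by fun_prop
  rw [ofReal_smoothedParam hρ.lamA_pos.le]
  calc ∫⁻ t in Set.Ioc 0 lamA, ENNReal.ofReal (1 - Real.exp (-(lamA - t) ^ 2 / (2 * σ ^ 2))) ^ S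
      ≤ ∫⁻ t in Set.Ioc 0 lamA,
          ENNReal.ofReal (1 - Real.exp (-(lamA - t) ^ 2 / (2 * σ ^ 2))) ^ Fintype.card κ :=
        lintegral_mono fun t => pow_le_pow_right_of_le_one' (ENNReal.ofReal_le_one.2
          (smoothedParam_base_mem_Icc lamA σ t).2) hκ
    _ ≤ ∫⁻ ω, ENNReal.ofReal (⨅ j, (inner ℝ x (Y j ω)) ^ 2) ∂P := by
        refine setLIntegral_pow_card_le_lintegral_iInf
          (Y := fun j ω => (inner ℝ x (Y j ω)) ^ 2) (fun j => hmeas_sq.comp (hY j))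
          (fun j ω => sq_nonneg _) (hindep.comp _ fun _ => hmeas_sq) measurableSet_Ioc
          Set.Ioc_subset_Ioi_self fun t ht j => ?_
        refine (hρ.le_measure_lt_inner_sq hx ht.2).trans_eq ?_
        rw [← hlaw j, Measure.map_apply (hY j) (measurableSet_lt measurable_const hmeas_sq)]
        rfl

lemma ActionRegularity.smoothedParam_mul_norm_sq_le_lintegral_iInf
    (hρ : ActionRegularity ρ lamA σ) (hκ : Fintype.card κ ≤ S) (hY : ∀ j, Measurable (Y j))
    (hlaw : ∀ j, P.map (Y j) = ρ) (hindep : iIndepFun Y P) (x : Vec d) :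
    ENNReal.ofReal (smoothedParam lamA σ S * ‖x‖ ^ 2)
      ≤ ∫⁻ ω, ENNReal.ofReal (⨅ j, (inner ℝ x (Y j ω)) ^ 2) ∂P := by
  rcases eq_or_ne x 0 with rfl | hx
  · simp
  set e : Vec d := ‖x‖⁻¹ • x
  have he : ‖e‖ = 1 := norm_smul_inv_norm hx
  have hscale (ω : Ω) : ⨅ j, (inner ℝ x (Y j ω)) ^ 2
      = (⨅ j, (inner ℝ e (Y j ω)) ^ 2) * ‖x‖ ^ 2 := by
    rw [Real.iInf_mul_of_nonneg (sq_nonneg _)]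
    congr 1 with j
    rw [← mul_pow, real_inner_smul_left]
    field_simp
  simp_rw [hscale, ENNReal.ofReal_mul' (sq_nonneg ‖x‖)]
  rw [lintegral_mul_const' _ _ ENNReal.ofReal_ne_top]
  gcongr
  exact hρ.smoothedParam_le_lintegral_iInf_of_norm_eq_one hκ hY hlaw hindep he

end ActionRegularity

section DesignForm

variable {E κ : Type*} [NormedAddCommGroup E] [InnerProductSpace ℝ E] [Fintype κ]

/-- The quadratic form `x ↦ xᵀ (∑ᵢ vᵢ vᵢᵀ) x` of a design `v`, which measures how much the design
explores the direction `x`. -/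
noncomputable def designForm (v : κ → E) (x : E) : ℝ :=
  ∑ i, (inner ℝ x (v i)) ^ 2

lemma designForm_nonneg (v : κ → E) (x : E) : 0 ≤ designForm v x :=
  Finset.sum_nonneg fun _ _ => sq_nonneg _

lemma designForm_smul (v : κ → E) (c : ℝ) (x : E) :
    designForm v (c • x) = c ^ 2 * designForm v x := by
  simp only [designForm, real_inner_smul_left, mul_pow, Finset.mul_sum]

lemma designForm_add (v : κ → E) (x y : E) :
    designForm v (x + y)
      = designForm v x + 2 * ∑ i, inner ℝ x (v i) * inner ℝ y (v i) + designForm v y := by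
  simp only [designForm, inner_add_left, Finset.mul_sum, ← Finset.sum_add_distrib]
  exact Finset.sum_congr rfl fun i _ => by ring

lemma designForm_add_le (v : κ → E) {η : ℝ} (hη : 0 < η) (x y : E) :
    designForm v (x + y) ≤ (1 + η) * designForm v x + (1 + η⁻¹) * designForm v y := by
  have hcross : 2 * ∑ i, inner ℝ x (v i) * inner ℝ y (v i)
      ≤ η * designForm v x + η⁻¹ * designForm v y := by
    simp only [designForm, Finset.mul_sum, ← Finset.sum_add_distrib]
    refine Finset.sum_le_sum fun i _ => ?_
    have hsq : 0 ≤ η⁻¹ * (η * inner ℝ x (v i) - inner ℝ y (v i)) ^ 2 := by positivity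
    field_simp at hsq ⊢
    linarith
  rw [designForm_add]
  linarith

lemma designForm_le {v : κ → E} (hv : ∀ i, ‖v i‖ ≤ 1) (x : E) :
    designForm v x ≤ Fintype.card κ * ‖x‖ ^ 2 := by
  have hterm (i : κ) : (inner ℝ x (v i)) ^ 2 ≤ ‖x‖ ^ 2 := by
    refine sq_le_sq.2 ((abs_real_inner_le_norm _ _).trans ?_)
    rw [abs_norm]
    exact mul_le_of_le_one_right (norm_nonneg x) (hv i)
  simpa [designForm] using Finset.sum_le_card_nsmul Finset.univ _ _ fun i _ => hterm i

lemma designForm_eq_of_finrank_eq_one (hE : Module.finrank ℝ E = 1) (v : κ → E) {x y : E}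
    (hxy : ‖x‖ = ‖y‖) : designForm v x = designForm v y := by
  rcases eq_or_ne y 0 with rfl | hy
  · rw [norm_eq_zero.1 (hxy.trans norm_zero)]
  obtain ⟨c, rfl⟩ := exists_smul_eq_of_finrank_eq_one hE hy x
  have hc : |c| = 1 := by
    rwa [norm_smul, Real.norm_eq_abs, mul_eq_right₀ (norm_ne_zero_iff.2 hy)] at hxy
  rw [designForm_smul, ← sq_abs, hc, one_pow, one_mul]

variable {Ω : Type*} [MeasurableSpace Ω] [MeasurableSpace E] [BorelSpace E]
  [SecondCountableTopology E]

lemma measurable_designForm {v : κ → Ω → E} (hv : ∀ i, Measurable (v i)) :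
    Measurable fun q : Ω × E => designForm (fun i => v i q.1) q.2 :=
  Finset.measurable_fun_sum _ fun i _ =>
    (measurable_snd.inner ((hv i).comp measurable_fst)).pow_const 2

end DesignForm

section Exploration

variable {E κ Ω : Type*} [NormedAddCommGroup E] [InnerProductSpace ℝ E] [Fintype κ]

lemma designForm_le_of_mem_closedBall {v : κ → E} (hv : ∀ i, ‖v i‖ ≤ 1) {t : ℝ}
    (ht : t ∈ Set.Icc (0 : ℝ) (1 / 2)) {x₀ x : E} (hx₀ : ‖x₀‖ = 1)
    (hform : designForm v x₀ ≤ t * Fintype.card κ / 2)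
    (hx : x ∈ Metric.closedBall ((1 - √t / 32) • x₀) (√t / 32)) :
    ‖x‖ ≤ 1 ∧ 29 / 32 ≤ ‖x‖ ^ 2 ∧
      designForm v x ≤ 561 / 1024 * (t * Fintype.card κ) := by
  set ε : ℝ := √t / 32 with hε
  have hε₀ : 0 ≤ ε := by positivity
  have hε₁ : ε ≤ 3 / 128 := by
    have : √t ≤ 3 / 4 := Real.sqrt_le_iff.2 ⟨by norm_num, by linarith [ht.2]⟩
    linarith
  have hε_sq : ε ^ 2 = t / 1024 := by
    rw [hε, div_pow, Real.sq_sqrt ht.1]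
    norm_num
  set y : E := (1 - ε) • x₀ with hy
  have hy_norm : ‖y‖ = 1 - ε := by
    rw [hy, norm_smul, hx₀, mul_one, Real.norm_of_nonneg (by linarith)]
  have hxy : ‖x - y‖ ≤ ε := mem_closedBall_iff_norm.1 hx
  have hx_lower : 61 / 64 ≤ ‖x‖ := by
    linarith [norm_sub_norm_le y x, norm_sub_rev y x]
  refine ⟨by linarith [norm_sub_norm_le x y], by nlinarith, ?_⟩
  have hform_y : designForm v y ≤ t * Fintype.card κ / 2 := by
    rw [hy, designForm_smul]
    exact (mul_le_of_le_one_left (designForm_nonneg v x₀)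
      (pow_le_one₀ (by linarith) (by linarith))).trans hform
  have hform_diff : designForm v (x - y) ≤ Fintype.card κ * (t / 1024) := by
    refine (designForm_le hv _).trans ?_
    rw [← hε_sq]
    gcongr
  have hadd := designForm_add_le v (η := 1 / 16) (by norm_num) y (x - y)
  rw [add_sub_cancel] at hadd
  norm_num at hadd
  linarith

variable [MeasurableSpace Ω] {P : Measure Ω} [MeasurableSpace E]
  [BorelSpace E] [FiniteDimensional ℝ E] {v : κ → Ω → E} {t : ℝ}

lemma measure_designForm_le_of_lintegral_exp_neg_le (hv : ∀ i, Measurable (v i)) (ht : 0 ≤ t)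
    {x : E} (hmom : ∫⁻ ω, ENNReal.ofReal (Real.exp (-(2 / 5 * designForm (v · ω) x))) ∂P
      ≤ ENNReal.ofReal (Real.exp (-(8 / 25 * (t * Fintype.card κ))))) :
    P {ω | designForm (v · ω) x ≤ t * Fintype.card κ / 2}
      ≤ ENNReal.ofReal (Real.exp (-(t * Fintype.card κ / 16))) := by
  have hform : Measurable fun ω => designForm (v · ω) x :=
    (measurable_designForm hv).comp (measurable_id.prodMk measurable_const)
  have hmarkov := mul_meas_ge_le_lintegral (μ := P)
    (f := fun ω => ENNReal.ofReal (Real.exp (-(2 / 5 * designForm (v · ω) x)))) (by fun_prop)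
    (ENNReal.ofReal (Real.exp (-(1 / 5 * (t * Fintype.card κ)))))
  have hsub : {ω | designForm (v · ω) x ≤ t * Fintype.card κ / 2}
      ⊆ {ω | ENNReal.ofReal (Real.exp (-(1 / 5 * (t * Fintype.card κ))))
        ≤ ENNReal.ofReal (Real.exp (-(2 / 5 * designForm (v · ω) x)))} := fun ω hω => by
    simp only [Set.mem_ofPred_eq] at hω ⊢
    exact ENNReal.ofReal_le_ofReal (Real.exp_le_exp.2 (by linarith))
  refine (ENNReal.mul_le_mul_iff_right (a := ENNReal.ofReal
    (Real.exp (-(1 / 5 * (t * Fintype.card κ))))) (by simp [Real.exp_pos]) (by simp)).1 ?_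
  refine ((mul_le_mul_right (measure_mono hsub) _).trans (hmarkov.trans hmom)).trans ?_
  rw [← ENNReal.ofReal_mul (Real.exp_nonneg _), ← Real.exp_add]
  gcongr
  have : 0 ≤ t * Fintype.card κ := by positivity
  linarith

lemma ofReal_mul_volume_closedBall_le_setLIntegral_exp_neg_designForm {v : κ → E}
    (hv : ∀ i, ‖v i‖ ≤ 1) (ht : t ∈ Set.Icc (0 : ℝ) (1 / 2)) {x₀ : E} (hx₀ : ‖x₀‖ = 1)
    (hform : designForm v x₀ ≤ t * Fintype.card κ / 2) :
    ENNReal.ofReal (Real.exp (-(2 / 5 * (561 / 1024 * (t * Fintype.card κ)))))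
        * (ENNReal.ofReal ((√t / 32) ^ Module.finrank ℝ E) * volume (Metric.closedBall (0 : E) 1))
      ≤ ∫⁻ x in Metric.closedBall (0 : E) 1 ∩ {x | 29 / 32 ≤ ‖x‖ ^ 2},
          ENNReal.ofReal (Real.exp (-(2 / 5 * designForm v x))) := by
  have hball := fun x => designForm_le_of_mem_closedBall (x := x) hv ht hx₀ hform
  rw [← Measure.addHaar_closedBall' _ ((1 - √t / 32) • x₀) (by positivity), ← setLIntegral_const]
  refine (setLIntegral_mono' Metric.isClosed_closedBall.measurableSet fun x hx => ?_).trans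
    (lintegral_mono_set fun x hx =>
      ⟨mem_closedBall_zero_iff.2 (hball x hx).1, (hball x hx).2.1⟩)
  exact ENNReal.ofReal_le_ofReal (Real.exp_le_exp.2 (neg_le_neg
    (mul_le_mul_of_nonneg_left (hball x hx).2.2 (by norm_num))))

-- A poorly explored direction is surrounded by a ball of such directions, so the bound for a fixed
-- direction may be averaged over all of them.
lemma mul_measure_exists_designForm_le [SFinite P] (hv : ∀ i, Measurable (v i))
    (hv_norm : ∀ᵐ ω ∂P, ∀ i, ‖v i ω‖ ≤ 1) (ht : t ∈ Set.Icc (0 : ℝ) (1 / 2))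
    (hmom : ∀ x : E, ‖x‖ ≤ 1 →
      ∫⁻ ω, ENNReal.ofReal (Real.exp (-(2 / 5 * designForm (v · ω) x))) ∂P
        ≤ ENNReal.ofReal (Real.exp (-(8 / 25 * (t * Fintype.card κ * ‖x‖ ^ 2))))) :
    ENNReal.ofReal ((√t / 32) ^ Module.finrank ℝ E) *
        P {ω | ∃ x : E, ‖x‖ = 1 ∧ designForm (v · ω) x ≤ t * Fintype.card κ / 2}
      ≤ ENNReal.ofReal (Real.exp (-(t * Fintype.card κ / 16))) := by
  have htn : 0 ≤ t * Fintype.card κ := mul_nonneg ht.1 (Nat.cast_nonneg _)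
  set ball : ℝ≥0∞ := volume (Metric.closedBall (0 : E) 1)
  set A : Set E := Metric.closedBall 0 1 ∩ {x | 29 / 32 ≤ ‖x‖ ^ 2}
  have hA : MeasurableSet A :=
    Metric.isClosed_closedBall.measurableSet.inter
      (measurableSet_le measurable_const (measurable_norm.pow_const 2))
  set B : Set Ω := {ω | ∃ x : E, ‖x‖ = 1 ∧ designForm (v · ω) x ≤ t * Fintype.card κ / 2}
  set volFactor : ℝ≥0∞ := ENNReal.ofReal ((√t / 32) ^ Module.finrank ℝ E)
  set c : ℝ≥0∞ := ENNReal.ofReal (Real.exp (-(2 / 5 * (561 / 1024 * (t * Fintype.card κ)))))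
  have hform := measurable_designForm hv
  have hmix : c * (volFactor * ball) * P B
      ≤ ∫⁻ _ in A, ENNReal.ofReal (Real.exp (-(8 / 25 * (t * Fintype.card κ * (29 / 32))))) := by
    refine mul_measure_le_lintegral_of_mixture
      (Φ := fun ω x => ENNReal.ofReal (Real.exp (-(2 / 5 * designForm (v · ω) x))))
      (by simp only [Function.uncurry_def]; fun_prop) ?_ ?_
    · refine ae_restrict_of_forall_mem hA fun x hx =>
        (hmom x (mem_closedBall_zero_iff.1 hx.1)).trans ?_
      exact ENNReal.ofReal_le_ofReal (Real.exp_le_exp.2 (neg_le_neg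
        (mul_le_mul_of_nonneg_left (mul_le_mul_of_nonneg_left hx.2 htn) (by norm_num))))
    · filter_upwards [hv_norm] with ω hω
      rintro ⟨x₀, hx₀, hle⟩
      exact ofReal_mul_volume_closedBall_le_setLIntegral_exp_neg_designForm hω ht hx₀ hle
  rw [setLIntegral_const] at hmix
  have hball_pos : ball ≠ 0 := (Metric.measure_closedBall_pos volume _ one_pos).ne'
  have hball_fin : ball ≠ ⊤ := measure_closedBall_lt_top.ne
  refine (ENNReal.mul_le_mul_iff_right (a := c * ball)
    (mul_ne_zero (by simp [c, Real.exp_pos]) hball_pos) (by finiteness)).1 ?_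
  calc c * ball * (volFactor * P B) = c * (volFactor * ball) * P B := by ring
    _ ≤ ENNReal.ofReal (Real.exp (-(8 / 25 * (t * Fintype.card κ * (29 / 32))))) * ball := by
        refine hmix.trans ?_
        gcongr
        exact measure_mono Set.inter_subset_left
    _ ≤ c * ENNReal.ofReal (Real.exp (-(t * Fintype.card κ / 16))) * ball := by
        rw [← ENNReal.ofReal_mul (Real.exp_nonneg _), ← Real.exp_add]
        gcongr
        linarith
    _ = c * ball * ENNReal.ofReal (Real.exp (-(t * Fintype.card κ / 16))) := by ring

lemma exp_neg_le_pow_of_le_sampleSize {k : ℕ} (hk : 0 < k) {t w n : ℝ} (ht : 0 < t)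
    (hkt : k * t ≤ 1) (hw : 0 < w) (hw₁ : w ≤ 1)
    (hn : 16 / t ^ 2 * Real.log (4 * k / (t ^ 2 * w)) ≤ n) :
    Real.exp (-(t * n / 16)) ≤ (t ^ 2 * w / (4 * k)) ^ k := by
  have hk₁ : (1 : ℝ) ≤ k := by exact_mod_cast hk
  have ht₁ : t ≤ 1 := (le_mul_of_one_le_left ht.le hk₁).trans hkt
  have hbase : t ^ 2 * w ≤ 4 * k :=
    (mul_le_one₀ (pow_le_one₀ ht.le ht₁) hw.le hw₁).trans (by linarith)
  set L : ℝ := Real.log (4 * k / (t ^ 2 * w)) with hL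
  have hL₀ : 0 ≤ L := Real.log_nonneg ((one_le_div (by positivity)).2 hbase)
  have hexp : Real.exp (-L) = t ^ 2 * w / (4 * k) := by
    rw [Real.exp_neg, hL, Real.exp_log (by positivity), inv_div]
  have hkL : k * L ≤ t * n / 16 :=
    calc k * L = k * t * (L / t) := by field_simp
      _ ≤ L / t := mul_le_of_le_one_left (by positivity) hkt
      _ = t * (16 / t ^ 2 * L) / 16 := by field_simp
      _ ≤ t * n / 16 := by gcongr
  rw [← hexp, ← Real.exp_nat_mul]
  exact Real.exp_le_exp.2 (by linarith)

lemma pow_sampleSize_le_mul_volume_factor {k : ℕ} (hk : 2 ≤ k) {t w : ℝ} (ht : 0 ≤ t)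
    (hkt : k * t ≤ 1) (hw : w ∈ Set.Icc (0 : ℝ) (1 / 2)) :
    (t ^ 2 * w / (4 * k)) ^ k ≤ (√t / 32) ^ k * w := by
  have hk₂ : (2 : ℝ) ≤ k := by exact_mod_cast hk
  have ht₂ : t ≤ 1 / 2 := by nlinarith
  set s : ℝ := √t
  set c : ℝ := √w
  have hs : s ^ 2 = t := Real.sq_sqrt ht
  have hc : c ^ 2 = w := Real.sq_sqrt hw.1
  have hc₁ : c ≤ 1 := Real.sqrt_le_one.2 (by linarith [hw.2])
  have hcs : c * s ^ 3 ≤ 1 / 4 := by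
    refine (sq_le_sq₀ (by positivity) (by norm_num)).1 ?_
    calc (c * s ^ 3) ^ 2 = w * t ^ 3 := by rw [← hc, ← hs]; ring
      _ ≤ 1 / 2 * (1 / 2) ^ 3 := by gcongr; exact hw.2
      _ = (1 / 4) ^ 2 := by norm_num
  have hfactor : c * t ^ 2 / (4 * k) ≤ s / 32 := by
    rw [div_le_div_iff₀ (by positivity) (by norm_num)]
    calc c * t ^ 2 * 32 = c * s ^ 3 * s * 32 := by rw [← hs]; ring
      _ ≤ 1 / 4 * s * 32 := by gcongr
      _ ≤ s * (4 * k) := by nlinarith [Real.sqrt_nonneg t]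
  calc (t ^ 2 * w / (4 * k)) ^ k = (c * t ^ 2 / (4 * k)) ^ k * c ^ k := by
        rw [← hc, ← mul_pow]; ring
    _ ≤ (s / 32) ^ k * c ^ 2 := by
        gcongr ?_ ^ k * ?_
        exact pow_le_pow_of_le_one (Real.sqrt_nonneg w) hc₁ hk
    _ = (s / 32) ^ k * w := by rw [hc]

lemma measure_exists_designForm_le [Nontrivial E] [SFinite P] (hv : ∀ i, Measurable (v i))
    (hv_norm : ∀ᵐ ω ∂P, ∀ i, ‖v i ω‖ ≤ 1) (ht : 0 < t) (hdt : Module.finrank ℝ E * t ≤ 1)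
    (hmom : ∀ x : E, ‖x‖ ≤ 1 →
      ∫⁻ ω, ENNReal.ofReal (Real.exp (-(2 / 5 * designForm (v · ω) x))) ∂P
        ≤ ENNReal.ofReal (Real.exp (-(8 / 25 * (t * Fintype.card κ * ‖x‖ ^ 2)))))
    {w : ℝ} (hw : w ∈ Set.Ioc (0 : ℝ) (1 / 2))
    (hn : 16 / t ^ 2 * Real.log (4 * Module.finrank ℝ E / (t ^ 2 * w)) ≤ Fintype.card κ) :
    P {ω | ∃ x : E, ‖x‖ = 1 ∧ designForm (v · ω) x ≤ t * Fintype.card κ / 2}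
      ≤ ENNReal.ofReal w := by
  have hexp := exp_neg_le_pow_of_le_sampleSize Module.finrank_pos ht hdt hw.1
    (by linarith [hw.2]) hn
  -- On a line the form takes the same value at both unit vectors, so no averaging is needed;
  -- there the volume factor would cost too much.
  rcases (Nat.succ_le_of_lt (Module.finrank_pos (R := ℝ) (M := E))).eq_or_lt with hd | hd
  · obtain ⟨e, he⟩ := exists_norm_eq E zero_le_one
    refine (measure_mono ?_).trans ((measure_designForm_le_of_lintegral_exp_neg_le hv ht.le
      (x := e) (by simpa [he] using hmom e he.le)).trans (ENNReal.ofReal_le_ofReal ?_))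
    · rintro ω ⟨x, hx, hle⟩
      exact (designForm_eq_of_finrank_eq_one hd.symm _ (he.trans hx.symm)).trans_le hle
    · rw [← hd] at hexp hdt
      norm_num at hexp hdt
      nlinarith [hw.1, mul_le_of_le_one_left hw.1.le (pow_le_one₀ (n := 2) ht.le hdt)]
  · have hvol : 0 < (√t / 32) ^ Module.finrank ℝ E := by positivity
    have ht₂ : t ≤ 1 / 2 := by
      have : (2 : ℝ) ≤ Module.finrank ℝ E := by exact_mod_cast hd
      nlinarith
    refine (ENNReal.mul_le_mul_iff_right (ENNReal.ofReal_pos.2 hvol).ne'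
      ENNReal.ofReal_ne_top).1 ((mul_measure_exists_designForm_le hv hv_norm ⟨ht.le, ht₂⟩
        hmom).trans ?_)
    rw [← ENNReal.ofReal_mul hvol.le]
    exact ENNReal.ofReal_le_ofReal (hexp.trans
      (pow_sampleSize_le_mul_volume_factor hd ht.le hdt ⟨hw.1.le, hw.2⟩))

end Exploration

section GaussianWeight

variable {E κ : Type*} [NormedAddCommGroup E] [InnerProductSpace ℝ E] [FiniteDimensional ℝ E]
  [MeasurableSpace E] [BorelSpace E] [Fintype κ]

lemma integrable_exp_neg_mul_norm_sq {b : ℝ} (hb : 0 < b) :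
    Integrable fun x : E => Real.exp (-b * ‖x‖ ^ 2) := by
  refine Integrable.of_integral_ne_zero ?_
  rw [GaussianFourier.integral_rexp_neg_mul_sq_norm hb]
  positivity

lemma integral_exp_neg_mul_norm_sq_eq {b c : ℝ} (hb : 0 < b) (hc : 0 < c) :
    ∫ x : E, Real.exp (-b * ‖x‖ ^ 2)
      = Real.exp (Module.finrank ℝ E / 2 * Real.log (c / b))
        * ∫ x : E, Real.exp (-c * ‖x‖ ^ 2) := by
  rw [GaussianFourier.integral_rexp_neg_mul_sq_norm hb,
    GaussianFourier.integral_rexp_neg_mul_sq_norm hc, mul_comm (_ / 2 : ℝ) (Real.log _),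
    ← Real.rpow_def_of_pos (by positivity), ← Real.mul_rpow (by positivity) (by positivity)]
  congr 1
  field_simp

lemma integrable_exp_neg_mul_norm_sq_mul {b C : ℝ} (hb : 0 < b) {f : E → ℝ}
    (hf : Continuous f) (hf_le : ∀ x, |f x| ≤ C * (1 + ‖x‖ ^ 2)) :
    Integrable fun x : E => Real.exp (-b * ‖x‖ ^ 2) * f x := by
  refine ((integrable_exp_neg_mul_norm_sq (E := E) (half_pos hb)).const_mul
    (C * (1 + 2 / b))).mono' (by fun_prop) (ae_of_all _ fun x => ?_)
  have hC : 0 ≤ C := by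
    simpa using (abs_nonneg (f 0)).trans (hf_le 0)
  have hsq : (b / 2 * ‖x‖ ^ 2) * Real.exp (-(b / 2) * ‖x‖ ^ 2) ≤ 1 := by
    rw [neg_mul, Real.exp_neg, ← div_eq_mul_inv, div_le_one (Real.exp_pos _)]
    linarith [Real.add_one_le_exp (b / 2 * ‖x‖ ^ 2)]
  have hexp : Real.exp (-(b / 2) * ‖x‖ ^ 2) ≤ 1 := Real.exp_le_one_iff.2 (by
    rw [neg_mul]; exact neg_nonpos.2 (by positivity))
  have hdom : Real.exp (-(b / 2) * ‖x‖ ^ 2) * (1 + ‖x‖ ^ 2) ≤ 1 + 2 / b := by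
    rw [mul_add, mul_one]
    refine add_le_add hexp ((le_div_iff₀ hb).2 ?_)
    linarith
  rw [norm_mul, Real.norm_of_nonneg (Real.exp_nonneg _), Real.norm_eq_abs]
  calc Real.exp (-b * ‖x‖ ^ 2) * |f x| ≤ Real.exp (-b * ‖x‖ ^ 2) * (C * (1 + ‖x‖ ^ 2)) := by
        gcongr
        exact hf_le x
    _ = C * (Real.exp (-(b / 2) * ‖x‖ ^ 2) * (1 + ‖x‖ ^ 2))
          * Real.exp (-(b / 2) * ‖x‖ ^ 2) := by
        rw [show -b * ‖x‖ ^ 2 = -(b / 2) * ‖x‖ ^ 2 + -(b / 2) * ‖x‖ ^ 2 by ring, Real.exp_add]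
        ring
    _ ≤ C * (1 + 2 / b) * Real.exp (-(b / 2) * ‖x‖ ^ 2) := by gcongr

lemma integrable_exp_neg_mul_norm_sq_mul_norm_sq {b : ℝ} (hb : 0 < b) :
    Integrable fun x : E => Real.exp (-b * ‖x‖ ^ 2) * ‖x‖ ^ 2 :=
  integrable_exp_neg_mul_norm_sq_mul (C := 1) hb (by fun_prop) fun x => by
    rw [abs_of_nonneg (sq_nonneg _)]; linarith

lemma integrable_exp_neg_mul_norm_sq_mul_inner {b : ℝ} (hb : 0 < b) (z : E) :
    Integrable fun x : E => Real.exp (-b * ‖x‖ ^ 2) * inner ℝ x z :=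
  integrable_exp_neg_mul_norm_sq_mul (C := ‖z‖) hb (by fun_prop) fun x => by
    nlinarith [abs_real_inner_le_norm x z, norm_nonneg z, sq_nonneg (‖x‖ - 1), sq_nonneg ‖x‖]

lemma integrable_exp_neg_mul_norm_sq_mul_inner_sq {b : ℝ} (hb : 0 < b) (z : E) :
    Integrable fun x : E => Real.exp (-b * ‖x‖ ^ 2) * inner ℝ x z ^ 2 :=
  integrable_exp_neg_mul_norm_sq_mul (C := ‖z‖ ^ 2) hb (by fun_prop) fun x => by
    rw [abs_of_nonneg (sq_nonneg _)]
    nlinarith [sq_le_sq' (neg_le_of_abs_le (abs_real_inner_le_norm x z))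
      (le_of_abs_le (abs_real_inner_le_norm x z)), sq_nonneg ‖z‖]

lemma integrable_exp_neg_mul_norm_sq_mul_designForm {b : ℝ} (hb : 0 < b) (v : κ → E) :
    Integrable fun x : E => Real.exp (-b * ‖x‖ ^ 2) * designForm v x := by
  simp only [designForm, Finset.mul_sum]
  exact integrable_finsetSum _ fun i _ => integrable_exp_neg_mul_norm_sq_mul_inner_sq hb (v i)

lemma integral_norm_mul_inner_eq_zero (f : ℝ → ℝ) (z : E) :
    ∫ x : E, f ‖x‖ * inner ℝ x z = 0 := by
  have hneg := integral_neg_eq_self (fun x : E => f ‖x‖ * inner ℝ x z) volume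
  simp only [norm_neg, inner_neg_left, mul_neg, integral_neg] at hneg
  linarith

lemma integral_norm_mul_inner_sq_eq (f : ℝ → ℝ) {y z : E} (hyz : ‖y‖ = ‖z‖) :
    ∫ x : E, f ‖x‖ * inner ℝ x y ^ 2 = ∫ x : E, f ‖x‖ * inner ℝ x z ^ 2 := by
  set T : E ≃ₗᵢ[ℝ] E := (ℝ ∙ (y - z))ᗮ.reflection
  have hT : T y = z := Submodule.reflection_sub hyz
  rw [← T.measurePreserving.integral_comp T.toHomeomorph.measurableEmbedding
    fun x => f ‖x‖ * inner ℝ x z ^ 2]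
  simp only [← hT, LinearIsometryEquiv.norm_map, LinearIsometryEquiv.inner_map_map]

lemma finrank_mul_integral_norm_mul_inner_sq (f : ℝ → ℝ)
    (hf : ∀ z : E, Integrable fun x : E => f ‖x‖ * inner ℝ x z ^ 2) (z : E) :
    Module.finrank ℝ E * ∫ x : E, f ‖x‖ * inner ℝ x z ^ 2
      = ‖z‖ ^ 2 * ∫ x : E, f ‖x‖ * ‖x‖ ^ 2 := by
  set b := stdOrthonormalBasis ℝ E
  have hb (i) : ‖z‖ ^ 2 * ∫ x : E, f ‖x‖ * inner ℝ x (b i) ^ 2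
      = ∫ x : E, f ‖x‖ * inner ℝ x z ^ 2 := by
    rw [integral_norm_mul_inner_sq_eq f (y := z) (z := ‖z‖ • b i) (by simp [norm_smul]),
      ← integral_const_mul]
    simp only [real_inner_smul_right, mul_pow]
    exact integral_congr_ae (ae_of_all _ fun x => by ring)
  have hsplit : ∫ x : E, f ‖x‖ * ‖x‖ ^ 2 = ∑ i, ∫ x : E, f ‖x‖ * inner ℝ x (b i) ^ 2 := by
    simp only [← b.sum_sq_inner_left, Finset.mul_sum]
    exact integral_finsetSum _ fun i _ => hf (b i)
  rw [hsplit, Finset.mul_sum, Finset.sum_congr rfl fun i _ => hb i]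
  simp

lemma finrank_mul_integral_norm_mul_designForm_le {f : ℝ → ℝ} (hf_nonneg : ∀ y, 0 ≤ f y)
    (hf : ∀ z : E, Integrable fun x : E => f ‖x‖ * inner ℝ x z ^ 2) {v : κ → E}
    (hv : ∀ i, ‖v i‖ ≤ 1) :
    Module.finrank ℝ E * ∫ x : E, f ‖x‖ * designForm v x
      ≤ Fintype.card κ * ∫ x : E, f ‖x‖ * ‖x‖ ^ 2 := by
  simp only [designForm, Finset.mul_sum]
  rw [integral_finsetSum _ fun i _ => hf (v i), Finset.mul_sum]
  simp only [finrank_mul_integral_norm_mul_inner_sq f hf]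
  refine (Finset.sum_le_card_nsmul _ _ (∫ x : E, f ‖x‖ * ‖x‖ ^ 2) fun i _ => ?_).trans_eq
    (by simp)
  exact mul_le_of_le_one_left (integral_nonneg fun x => mul_nonneg (hf_nonneg _) (sq_nonneg _))
    (pow_le_one₀ (norm_nonneg _) (hv i))

end GaussianWeight

section SelfNormalized

variable {E κ Ω : Type*} [NormedAddCommGroup E] [InnerProductSpace ℝ E] [FiniteDimensional ℝ E]
  [Nontrivial E] [MeasurableSpace E] [BorelSpace E] [Fintype κ] {lam : ℝ}

lemma integrable_and_integral_trace_sub_nonneg {b : ℝ} (hb : 0 < b) {v : κ → E}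
    (hv : ∀ i, ‖v i‖ ≤ 1) (z : E) :
    Integrable (fun x : E => Real.exp (-b * ‖x‖ ^ 2) * (inner ℝ x z
      + (Fintype.card κ / Module.finrank ℝ E * ‖x‖ ^ 2 - designForm v x) / 2)) ∧
    0 ≤ ∫ x : E, Real.exp (-b * ‖x‖ ^ 2) * (inner ℝ x z
      + (Fintype.card κ / Module.finrank ℝ E * ‖x‖ ^ 2 - designForm v x) / 2) := by
  have hd : (0 : ℝ) < Module.finrank ℝ E := Nat.cast_pos.2 Module.finrank_pos
  have hodd := integral_norm_mul_inner_eq_zero (fun y => Real.exp (-b * y ^ 2)) z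
  have htrace := finrank_mul_integral_norm_mul_designForm_le (f := fun y => Real.exp (-b * y ^ 2))
    (fun y => (Real.exp_pos _).le) (integrable_exp_neg_mul_norm_sq_mul_inner_sq hb) hv
  have hinner := integrable_exp_neg_mul_norm_sq_mul_inner hb z
  have hsq := (integrable_exp_neg_mul_norm_sq_mul_norm_sq (E := E) hb).const_mul
    (Fintype.card κ / Module.finrank ℝ E / 2 : ℝ)
  have hform := (integrable_exp_neg_mul_norm_sq_mul_designForm hb v).const_mul (1 / 2)
  have hsplit : (fun x : E => Real.exp (-b * ‖x‖ ^ 2) * (inner ℝ x z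
        + (Fintype.card κ / Module.finrank ℝ E * ‖x‖ ^ 2 - designForm v x) / 2))
      = (fun x : E => Real.exp (-b * ‖x‖ ^ 2) * inner ℝ x z)
        + ((fun x : E => Fintype.card κ / Module.finrank ℝ E / 2
            * (Real.exp (-b * ‖x‖ ^ 2) * ‖x‖ ^ 2))
          - fun x : E => 1 / 2 * (Real.exp (-b * ‖x‖ ^ 2) * designForm v x)) := by
    ext x
    simp only [Pi.add_apply, Pi.sub_apply]
    ring
  rw [hsplit, integral_add' hinner (hsq.sub hform), integral_sub' hsq hform, integral_const_mul,
    integral_const_mul, hodd]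
  refine ⟨hinner.add (hsq.sub hform), ?_⟩
  have hquad := sub_nonneg.2 ((le_div_iff₀' hd).2 htrace)
  calc (0 : ℝ) ≤ _ := div_nonneg hquad zero_le_two
    _ = _ := by ring

-- The weight is the Gaussian whose precision is the isotropic matrix with the largest trace allowed
-- for that of the exponent. The tangent bound `1 + y ≤ exp y` then replaces the determinant-trace
-- inequality: the linear term is odd and the quadratic one has nonnegative mean.
lemma ofReal_integral_exp_neg_mul_norm_sq_le_lintegral {v : κ → E} (hv : ∀ i, ‖v i‖ ≤ 1)
    (hlam : 0 < lam) (z : E) :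
    ENNReal.ofReal (∫ x : E, Real.exp
        (-((lam + Fintype.card κ / Module.finrank ℝ E) / 2) * ‖x‖ ^ 2))
      ≤ ∫⁻ x : E, ENNReal.ofReal
        (Real.exp (inner ℝ x z - (lam * ‖x‖ ^ 2 + designForm v x) / 2)) := by
  set m : ℝ := Fintype.card κ / Module.finrank ℝ E
  have hb : 0 < (lam + m) / 2 := by positivity
  set g : E → ℝ := fun x => Real.exp (-((lam + m) / 2) * ‖x‖ ^ 2)
  set tilt : E → ℝ := fun x => inner ℝ x z + (m * ‖x‖ ^ 2 - designForm v x) / 2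
  have hg : Integrable g := integrable_exp_neg_mul_norm_sq hb
  obtain ⟨hg_tilt, htilt_nonneg⟩ := integrable_and_integral_trace_sub_nonneg hb hv z
  have htangent (x : E) : g x + g x * tilt x
      ≤ Real.exp (inner ℝ x z - (lam * ‖x‖ ^ 2 + designForm v x) / 2) :=
    calc g x + g x * tilt x = g x * (tilt x + 1) := by ring
      _ ≤ g x * Real.exp (tilt x) :=
        mul_le_mul_of_nonneg_left (Real.add_one_le_exp _) (Real.exp_nonneg _)
      _ = Real.exp (inner ℝ x z - (lam * ‖x‖ ^ 2 + designForm v x) / 2) := by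
        rw [← Real.exp_add]
        congr 1
        ring
  calc ENNReal.ofReal (∫ x, g x) ≤ ENNReal.ofReal (∫ x, g x + g x * tilt x) := by
        rw [integral_add hg hg_tilt]
        exact ENNReal.ofReal_le_ofReal (le_add_of_nonneg_right htilt_nonneg)
    _ ≤ ∫⁻ x, ENNReal.ofReal (g x + g x * tilt x) := ofReal_integral_le_lintegral_ofReal _ _
    _ ≤ _ := lintegral_mono fun x => ENNReal.ofReal_le_ofReal (htangent x)

lemma ofReal_exp_mul_integral_le_lintegral {v : κ → E} (hv : ∀ i, ‖v i‖ ≤ 1) (hlam : 0 < lam)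
    (s w : E) :
    ENNReal.ofReal (Real.exp (inner ℝ w s - (lam * ‖w‖ ^ 2 + designForm v w) / 2)
        * ∫ x : E, Real.exp (-((lam + Fintype.card κ / Module.finrank ℝ E) / 2) * ‖x‖ ^ 2))
      ≤ ∫⁻ x : E, ENNReal.ofReal
        (Real.exp (inner ℝ x s - (lam * ‖x‖ ^ 2 + designForm v x) / 2)) := by
  set z : E := s - lam • w - ∑ i, inner ℝ w (v i) • v i with hz
  have hinner (x : E) : inner ℝ x z
      = inner ℝ x s - lam * inner ℝ w x - ∑ i, inner ℝ w (v i) * inner ℝ x (v i) := by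
    simp only [hz, inner_sub_right, inner_sum, real_inner_smul_right, real_inner_comm]
  have hshift (x : E) :
      inner ℝ (w + x) s - (lam * ‖w + x‖ ^ 2 + designForm v (w + x)) / 2
        = (inner ℝ w s - (lam * ‖w‖ ^ 2 + designForm v w) / 2)
          + (inner ℝ x z - (lam * ‖x‖ ^ 2 + designForm v x) / 2) := by
    rw [hinner, designForm_add, norm_add_sq_real, inner_add_left]
    ring
  rw [← lintegral_add_left_eq_self _ w]
  simp only [hshift, Real.exp_add, ENNReal.ofReal_mul (Real.exp_nonneg _)]
  rw [lintegral_const_mul' _ _ ENNReal.ofReal_ne_top]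
  gcongr
  exact ofReal_integral_exp_neg_mul_norm_sq_le_lintegral hv hlam z

variable [MeasurableSpace Ω] {P : Measure Ω} [SFinite P]

lemma integral_exp_neg_half_mul_norm_sq_eq (hlam : 0 < lam) {n : ℝ} (hn : 0 ≤ n) :
    ∫ x : E, Real.exp (-(lam / 2) * ‖x‖ ^ 2)
      = Real.exp (Module.finrank ℝ E * Real.log (1 + n / (lam * Module.finrank ℝ E)) / 2)
        * ∫ x : E, Real.exp (-((lam + n / Module.finrank ℝ E) / 2) * ‖x‖ ^ 2) := by
  have hd : (0 : ℝ) < Module.finrank ℝ E := Nat.cast_pos.2 Module.finrank_pos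
  have hratio : (lam + n / Module.finrank ℝ E) / 2 / (lam / 2)
      = 1 + n / (lam * Module.finrank ℝ E) := by field_simp
  rw [integral_exp_neg_mul_norm_sq_eq (c := (lam + n / Module.finrank ℝ E) / 2) (half_pos hlam)
    (by positivity), hratio, div_mul_eq_mul_div]

lemma measure_exists_selfNormalized_lt {v : κ → Ω → E} (hv : ∀ i, Measurable (v i))
    (hv_norm : ∀ᵐ ω ∂P, ∀ i, ‖v i ω‖ ≤ 1) {s : Ω → E} (hs : Measurable s)
    (hmom : ∀ x : E, ∫⁻ ω, ENNReal.ofReal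
      (Real.exp (inner ℝ x (s ω) - designForm (v · ω) x / 2)) ∂P ≤ 1)
    (hlam : 0 < lam) {ε : ℝ} (hε : 0 < ε) :
    P {ω | ∃ w : E, Module.finrank ℝ E
          * Real.log (1 + Fintype.card κ / (lam * Module.finrank ℝ E)) + 2 * Real.log (1 / ε)
          + (lam * ‖w‖ ^ 2 + designForm (v · ω) w) < 2 * inner ℝ w (s ω)}
      ≤ ENNReal.ofReal ε := by
  set L : ℝ := Module.finrank ℝ E
    * Real.log (1 + Fintype.card κ / (lam * Module.finrank ℝ E))
  set B : Set Ω := {ω | ∃ w : E, L + 2 * Real.log (1 / ε)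
    + (lam * ‖w‖ ^ 2 + designForm (v · ω) w) < 2 * inner ℝ w (s ω)}
  set prior : ℝ := ∫ x : E, Real.exp (-(lam / 2) * ‖x‖ ^ 2) with hprior
  have hform := measurable_designForm hv
  have hmix : ENNReal.ofReal (1 / ε * prior) * P B
      ≤ ∫⁻ x : E, ENNReal.ofReal (Real.exp (-(lam / 2) * ‖x‖ ^ 2)) := by
    refine mul_measure_le_lintegral_of_mixture (Φ := fun ω x => ENNReal.ofReal
      (Real.exp (inner ℝ x (s ω) - (lam * ‖x‖ ^ 2 + designForm (v · ω) x) / 2)))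
      (by simp only [Function.uncurry_def]; fun_prop) (ae_of_all _ fun x => ?_) ?_
    · have hsplit (ω : Ω) : inner ℝ x (s ω) - (lam * ‖x‖ ^ 2 + designForm (v · ω) x) / 2
          = -(lam / 2) * ‖x‖ ^ 2 + (inner ℝ x (s ω) - designForm (v · ω) x / 2) := by ring
      simp only [hsplit, Real.exp_add, ENNReal.ofReal_mul (Real.exp_nonneg _)]
      rw [lintegral_const_mul' _ _ ENNReal.ofReal_ne_top]
      exact mul_le_of_le_one_right zero_le (hmom x)
    · filter_upwards [hv_norm] with ω hω
      rintro ⟨w, hw⟩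
      refine le_trans (ENNReal.ofReal_le_ofReal ?_)
        (ofReal_exp_mul_integral_le_lintegral hω hlam (s ω) w)
      rw [hprior, integral_exp_neg_half_mul_norm_sq_eq hlam (Nat.cast_nonneg _), ← mul_assoc,
        ← Real.exp_log (one_div_pos.2 hε), ← Real.exp_add]
      gcongr
      linarith
  rw [← ofReal_integral_eq_lintegral_ofReal (integrable_exp_neg_mul_norm_sq (half_pos hlam))
    (ae_of_all _ fun x => Real.exp_nonneg _), ← hprior] at hmix
  have hprior_pos : 0 < prior := by
    rw [hprior, GaussianFourier.integral_rexp_neg_mul_sq_norm (half_pos hlam)]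
    positivity
  refine (ENNReal.mul_le_mul_iff_right (a := ENNReal.ofReal (1 / ε * prior))
    (ENNReal.ofReal_pos.2 (by positivity)).ne' ENNReal.ofReal_ne_top).1 (hmix.trans_eq ?_)
  rw [← ENNReal.ofReal_mul (by positivity)]
  congr 1
  field_simp

end SelfNormalized

section LeastSquares

variable {E κ : Type*} [NormedAddCommGroup E] [InnerProductSpace ℝ E] [Fintype κ]

lemma mul_norm_sq_le_designForm {v : κ → E} {c : ℝ}
    (hv : ∀ x : E, ‖x‖ = 1 → c ≤ designForm v x) (x : E) : c * ‖x‖ ^ 2 ≤ designForm v x := by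
  rcases eq_or_ne x 0 with rfl | hx
  · simp [designForm]
  have hunit := hv (‖x‖⁻¹ • x) (norm_smul_inv_norm hx)
  rwa [designForm_smul, inv_pow, inv_mul_eq_div, le_div_iff₀ (by positivity)] at hunit

/-- The noise vector `∑ᵢ (yᵢ - ⟪θ, vᵢ⟫) vᵢ` of a linear model with parameter `θ`, design `v` and
responses `y`. -/
noncomputable def noiseVector (θ : E) (v : κ → E) (y : κ → ℝ) : E :=
  ∑ i, (y i - inner ℝ θ (v i)) • v i

lemma inner_sq_le_of_forall_two_mul_inner_le {v : κ → E} {lam β : ℝ} {s : E}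
    (hs : ∀ w : E, 2 * inner ℝ w s ≤ β + (lam * ‖w‖ ^ 2 + designForm v w)) (h : E) :
    inner ℝ h s ^ 2 ≤ β * (lam * ‖h‖ ^ 2 + designForm v h) := by
  have hdiscrim : discrim (lam * ‖h‖ ^ 2 + designForm v h) (-(2 * inner ℝ h s)) β ≤ 0 := by
    refine discrim_le_zero fun τ => ?_
    have hτ := hs (τ • h)
    rw [real_inner_smul_left, norm_smul, mul_pow, Real.norm_eq_abs, sq_abs, designForm_smul] at hτ
    linarith
  rw [discrim] at hdiscrim
  linarith

lemma norm_le_of_quadraticForm_eq {v : κ → E} {lam β c : ℝ} {h s θ : E} (hlam : 0 ≤ lam)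
    (hθ : ‖θ‖ ≤ 1) (hc : 0 < c) (hexplored : c * ‖h‖ ^ 2 ≤ designForm v h)
    (hs : ∀ w : E, 2 * inner ℝ w s ≤ β + (lam * ‖w‖ ^ 2 + designForm v w))
    (heq : lam * ‖h‖ ^ 2 + designForm v h = inner ℝ h s - lam * inner ℝ h θ) :
    ‖h‖ ≤ (√β + √lam) / √c := by
  set q : ℝ := lam * ‖h‖ ^ 2 + designForm v h
  have hβ : 0 ≤ β := by simpa [designForm] using hs 0
  have hq : 0 ≤ q := add_nonneg (by positivity) (designForm_nonneg v h)
  have hnoise : inner ℝ h s ≤ √β * √q := by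
    rw [← Real.sqrt_mul hβ]
    exact Real.le_sqrt_of_sq_le (inner_sq_le_of_forall_two_mul_inner_le hs h)
  have hbias : -(lam * inner ℝ h θ) ≤ √lam * √q := by
    have hinner : -inner ℝ h θ ≤ ‖h‖ :=
      (neg_le_abs _).trans ((abs_real_inner_le_norm h θ).trans
        (mul_le_of_le_one_right (norm_nonneg h) hθ))
    have hnorm : √lam * ‖h‖ ≤ √q := by
      refine Real.le_sqrt_of_sq_le ?_
      rw [mul_pow, Real.sq_sqrt hlam]
      exact le_add_of_nonneg_right (designForm_nonneg v h)
    calc -(lam * inner ℝ h θ) = √lam * (√lam * -inner ℝ h θ) := by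
          rw [← mul_assoc, Real.mul_self_sqrt hlam, mul_neg]
      _ ≤ √lam * √q := by gcongr; exact le_trans (by gcongr) hnorm
  have hsqrt : √q ≤ √β + √lam := by
    rcases (Real.sqrt_nonneg q).eq_or_lt with hq₀ | hq₀
    · rw [← hq₀]; positivity
    · refine le_of_mul_le_mul_right ?_ hq₀
      rw [Real.mul_self_sqrt hq]
      linarith
  rw [le_div_iff₀ (Real.sqrt_pos.2 hc)]
  refine le_trans (Real.le_sqrt_of_sq_le ?_) hsqrt
  rw [mul_pow, Real.sq_sqrt hc.le, mul_comm]
  exact hexplored.trans (le_add_of_nonneg_left (by positivity))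

end LeastSquares

section Ridge

variable {ι : Type*} {N : ι → ℕ} {d : ℕ} {lam : ℝ}

lemma ofLp_dotProduct_ofLp (x y : Vec d) : x.ofLp ⬝ᵥ y.ofLp = inner ℝ x y := by
  simp [EuclideanSpace.inner_eq_star_dotProduct, dotProduct_comm]

lemma dotProduct_gram_mulVec (D : Dataset ι N d) (u : ι) (x y : Vec d) :
    y.ofLp ⬝ᵥ (gram lam D u *ᵥ x.ofLp)
      = lam * inner ℝ y x + ∑ i, inner ℝ x (D u i).1 * inner ℝ y (D u i).1 := by
  have hgram : gram lam D u *ᵥ x.ofLp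
      = (lam • x + ∑ i, inner ℝ (D u i).1 x • (D u i).1).ofLp := by
    simp only [gram, Matrix.add_mulVec, Matrix.smul_mulVec, Matrix.one_mulVec, Matrix.sum_mulVec,
      Matrix.vecMulVec_mulVec, ofLp_dotProduct_ofLp, WithLp.ofLp_add, WithLp.ofLp_smul,
      WithLp.ofLp_sum, op_smul_eq_smul]
  rw [hgram, ofLp_dotProduct_ofLp, inner_add_right, inner_sum, real_inner_smul_right]
  simp only [real_inner_smul_right, real_inner_comm]

lemma gram_posDef (hlam : 0 < lam) (D : Dataset ι N d) (u : ι) : (gram lam D u).PosDef := by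
  refine Matrix.PosDef.of_dotProduct_mulVec_pos ?_ fun {x} hx => ?_
  · ext i j
    simp [gram, Matrix.sum_apply, Matrix.vecMulVec_apply, Matrix.one_apply, mul_comm, eq_comm]
  · have hnorm : 0 < ‖WithLp.toLp 2 x‖ := norm_pos_iff.2 (by simpa using hx)
    rw [star_trivial, show x = (WithLp.toLp 2 x).ofLp from rfl, dotProduct_gram_mulVec,
      real_inner_self_eq_norm_sq]
    exact add_pos_of_pos_of_nonneg (by positivity)
      (Finset.sum_nonneg fun i _ => mul_self_nonneg _)

lemma gram_mulVec_ridge (hlam : 0 < lam) (D : Dataset ι N d) (u : ι) :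
    gram lam D u *ᵥ (ridge lam D u).ofLp = (moment D u).ofLp := by
  rw [ridge, Matrix.mulVec_mulVec,
    Matrix.mul_nonsing_inv _ (gram_posDef hlam D u).det_pos.ne'.isUnit, Matrix.one_mulVec]

lemma quadraticForm_ridge_sub_eq (hlam : 0 < lam) (D : Dataset ι N d) (u : ι) (θ : Vec d) :
    lam * ‖ridge lam D u - θ‖ ^ 2 + designForm (fun i => (D u i).1) (ridge lam D u - θ)
      = inner ℝ (ridge lam D u - θ)
          (noiseVector θ (fun i => (D u i).1) fun i => (D u i).2)
        - lam * inner ℝ (ridge lam D u - θ) θ := by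
  set h : Vec d := ridge lam D u - θ
  have hridge : ridge lam D u = h + θ := (sub_add_cancel _ _).symm
  have hnormal : lam * inner ℝ h (ridge lam D u)
      + ∑ i, inner ℝ (ridge lam D u) (D u i).1 * inner ℝ h (D u i).1
      = ∑ i, (D u i).2 * inner ℝ h (D u i).1 := by
    rw [← dotProduct_gram_mulVec, gram_mulVec_ridge hlam, ofLp_dotProduct_ofLp, moment, inner_sum]
    simp only [real_inner_smul_right]
  simp only [hridge, inner_add_left, inner_add_right, add_mul, Finset.sum_add_distrib,
    real_inner_self_eq_norm_sq] at hnormal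
  simp only [noiseVector, designForm, inner_sum, real_inner_smul_right, sub_mul,
    Finset.sum_sub_distrib, sq (inner ℝ h _)]
  linarith

lemma norm_ridge_sub_le (hlam : 0 < lam) (D : Dataset ι N d) (u : ι) {θ : Vec d}
    (hθ : ‖θ‖ ≤ 1) {c β : ℝ} (hc : 0 < c)
    (hexplored : ∀ x : Vec d, ‖x‖ = 1 → c ≤ designForm (fun i => (D u i).1) x)
    (hnoise : ∀ w : Vec d, 2 * inner ℝ w (noiseVector θ (fun i => (D u i).1) fun i => (D u i).2)
      ≤ β + (lam * ‖w‖ ^ 2 + designForm (fun i => (D u i).1) w)) :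
    ‖ridge lam D u - θ‖ ≤ (√β + √lam) / √c :=
  norm_le_of_quadraticForm_eq hlam.le hθ hc (mul_norm_sq_le_designForm hexplored _) hnoise
    (quadraticForm_ridge_sub_eq hlam D u θ)

end Ridge

section History

variable {Ω : Type*} {ι : Type*} {N : ι → ℕ} {d : ℕ} {K : (u : ι) → Fin (N u) → ℕ}
  {X : (u : ι) → (i : Fin (N u)) → Fin (K u i) → Ω → Vec d}
  {a : (u : ι) → Fin (N u) → Ω → Vec d} {r : (u : ι) → Fin (N u) → Ω → ℝ}
  {u : ι} {i j : Fin (N u)}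

lemma measurable_cand_history (hji : j < i) (k : Fin (K u j)) :
    Measurable[history K X a r u i] (X u j k) :=
  measurable_iff_comap_le.2 <| le_iSup₂_of_le j hji <| le_sup_of_le_left <| le_sup_of_le_left <|
    le_iSup (fun k => MeasurableSpace.comap (X u j k) inferInstance) k

lemma measurable_action_history (hji : j < i) : Measurable[history K X a r u i] (a u j) :=
  measurable_iff_comap_le.2 <| le_iSup₂_of_le j hji <| le_sup_of_le_left le_sup_right

lemma measurable_reward_history (hji : j < i) : Measurable[history K X a r u i] (r u j) :=
  measurable_iff_comap_le.2 <| le_iSup₂_of_le j hji le_sup_right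

end History

lemma measurable_iInf_inner_sq {Ω κ E : Type*} {m : MeasurableSpace Ω} [Countable κ]
    [NormedAddCommGroup E] [InnerProductSpace ℝ E] [MeasurableSpace E] [OpensMeasurableSpace E]
    {Y : κ → Ω → E} (hY : ∀ k, Measurable (Y k)) (x : E) :
    Measurable fun ω => ⨅ k, (inner ℝ x (Y k ω)) ^ 2 :=
  Measurable.iInf fun k =>
    (show Continuous fun y : E => (inner ℝ x y) ^ 2 by fun_prop).measurable.comp (hY k)

section OfflineData

variable {Ω : Type*} [mΩ : MeasurableSpace Ω] {P : Measure Ω}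
  {ι : Type*} {N : ι → ℕ} {d : ℕ} {ρ : Measure (Vec d)} {lamA σ : ℝ} {S : ℕ} {θ : ι → Vec d}
  {R : ι → Kernel (Vec d) ℝ} {K : (u : ι) → Fin (N u) → ℕ}
  {X : (u : ι) → (i : Fin (N u)) → Fin (K u i) → Ω → Vec d}
  {a : (u : ι) → Fin (N u) → Ω → Vec d} {r : (u : ι) → Fin (N u) → Ω → ℝ}

lemma IsOfflineData.cand_le (hdata : IsOfflineData P ρ S R K X a r) (u : ι) (i : Fin (N u)) :
    (⨆ k, MeasurableSpace.comap (X u i k) inferInstance) ≤ mΩ :=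
  iSup_le fun k => (hdata.measurable_cand u i k).comap_le

lemma IsOfflineData.history_le (hdata : IsOfflineData P ρ S R K X a r) (u : ι) (i : Fin (N u)) :
    history K X a r u i ≤ mΩ :=
  iSup₂_le fun j _ => sup_le (sup_le (hdata.cand_le u j) (hdata.measurable_action u j).comap_le)
    (hdata.measurable_reward u j).comap_le

lemma IsOfflineData.norm_cand_le (hdata : IsOfflineData P ρ S R K X a r)
    (hρ : ∀ᵐ a ∂ρ, ‖a‖ ≤ 1) (u : ι) (i : Fin (N u)) : ∀ᵐ ω ∂P, ∀ k, ‖X u i k ω‖ ≤ 1 := by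
  refine ae_all_iff.2 fun k => ?_
  rw [← hdata.cand_law u i k] at hρ
  exact ae_of_ae_map (hdata.measurable_cand u i k).aemeasurable hρ

lemma IsOfflineData.norm_action_le (hdata : IsOfflineData P ρ S R K X a r)
    (hρ : ∀ᵐ a ∂ρ, ‖a‖ ≤ 1) (u : ι) : ∀ᵐ ω ∂P, ∀ i, ‖a u i ω‖ ≤ 1 := by
  refine ae_all_iff.2 fun i => ?_
  filter_upwards [hdata.norm_cand_le hρ u i, hdata.action_mem u i] with ω hcand ⟨k, hk⟩
  exact hk ▸ hcand k

lemma IsOfflineData.card_pos [NeZero P] (hdata : IsOfflineData P ρ S R K X a r) (u : ι)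
    (i : Fin (N u)) : 0 < K u i := by
  obtain ⟨ω, k, -⟩ := (hdata.action_mem u i).exists
  exact k.pos

lemma IsOfflineData.lintegral_exp_neg_iInf_inner_sq_le [IsProbabilityMeasure P]
    (hdata : IsOfflineData P ρ S R K X a r) (hρ : ActionRegularity ρ lamA σ) (u : ι)
    (i : Fin (N u)) {x : Vec d} (hx : ‖x‖ ≤ 1) {s : ℝ} (hs : s ∈ Set.Icc 0 2) :
    ∫⁻ ω, ENNReal.ofReal (Real.exp (-(s * ⨅ k, (inner ℝ x (X u i k ω)) ^ 2))) ∂P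
      ≤ ENNReal.ofReal
          (Real.exp (-((s - s ^ 2 / 2) * (smoothedParam lamA σ S * ‖x‖ ^ 2)))) := by
  have : Nonempty (Fin (K u i)) := ⟨⟨0, hdata.card_pos u i⟩⟩
  refine lintegral_exp_neg_mul_le (measurable_iInf_inner_sq (hdata.measurable_cand u i) x)
    (ae_of_all _ fun ω => Real.iInf_nonneg fun k => sq_nonneg _) ?_ hs
    (hρ.smoothedParam_mul_norm_sq_le_lintegral_iInf
      ((Fintype.card_fin _).trans_le (hdata.card_le u i)) (hdata.measurable_cand u i)
      (hdata.cand_law u i) (hdata.cand_iIndep u i) x)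
  filter_upwards [hdata.norm_cand_le hρ.norm_le_one u i] with ω hω
  refine (ciInf_le (Finite.bddBelow_range _) (Classical.arbitrary _)).trans ?_
  exact (sq_le_one_iff_abs_le_one _).2 ((abs_real_inner_le_norm _ _).trans
    (mul_le_one₀ hx (norm_nonneg _) (hω _)))

lemma IsOfflineData.lintegral_prod_exp_neg_iInf_inner_sq_le [IsProbabilityMeasure P]
    (hdata : IsOfflineData P ρ S R K X a r) (hρ : ActionRegularity ρ lamA σ) (u : ι)
    {x : Vec d} (hx : ‖x‖ ≤ 1) {s : ℝ} (hs : s ∈ Set.Icc 0 2) :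
    ∫⁻ ω, ∏ i, ENNReal.ofReal (Real.exp (-(s * ⨅ k, (inner ℝ x (X u i k ω)) ^ 2))) ∂P
      ≤ ENNReal.ofReal
          (Real.exp (-((s - s ^ 2 / 2) * (smoothedParam lamA σ S * ‖x‖ ^ 2)))) ^ N u := by
  have hmeas (i : Fin (N u)) (m : MeasurableSpace Ω) (hX : ∀ k, Measurable[m] (X u i k)) :
      Measurable[m] fun ω =>
        ENNReal.ofReal (Real.exp (-(s * ⨅ k, (inner ℝ x (X u i k ω)) ^ 2))) := by
    have := measurable_iInf_inner_sq hX x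
    fun_prop
  refine (lintegral_prod_le_of_forall_weight (history K X a r u) _
    (fun _ => ENNReal.ofReal
      (Real.exp (-((s - s ^ 2 / 2) * (smoothedParam lamA σ S * ‖x‖ ^ 2)))))
    (fun i j hji => hmeas j _ fun k => measurable_cand_history hji k) fun i W hW => ?_).trans_eq
      (by simp)
  rw [lintegral_mul_eq_lintegral_mul_lintegral_of_independent_measurableSpace
    (hdata.history_le u i) (hdata.cand_le u i) (hdata.cand_fresh u i).symm hW
    (hmeas i _ fun k => measurable_iff_comap_le.2
      (le_iSup (fun k => MeasurableSpace.comap (X u i k) inferInstance) k)), mul_comm]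
  gcongr
  exact hdata.lintegral_exp_neg_iInf_inner_sq_le hρ u i hx hs

lemma IsOfflineData.lintegral_exp_neg_designForm_le [IsProbabilityMeasure P]
    (hdata : IsOfflineData P ρ S R K X a r) (hρ : ActionRegularity ρ lamA σ) (u : ι)
    {x : Vec d} (hx : ‖x‖ ≤ 1) {s : ℝ} (hs : s ∈ Set.Icc 0 2) :
    ∫⁻ ω, ENNReal.ofReal (Real.exp (-(s * designForm (a u · ω) x))) ∂P
      ≤ ENNReal.ofReal (Real.exp
          (-((s - s ^ 2 / 2) * (smoothedParam lamA σ S * N u * ‖x‖ ^ 2)))) := by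
  calc ∫⁻ ω, ENNReal.ofReal (Real.exp (-(s * designForm (a u · ω) x))) ∂P
      ≤ ∫⁻ ω, ∏ i, ENNReal.ofReal (Real.exp (-(s * ⨅ k, (inner ℝ x (X u i k ω)) ^ 2))) ∂P := by
        refine lintegral_mono_ae ?_
        filter_upwards [ae_all_iff.2 (hdata.action_mem u)] with ω hω
        rw [← ENNReal.ofReal_prod_of_nonneg fun _ _ => Real.exp_nonneg _, ← Real.exp_sum,
          Finset.sum_neg_distrib, ← Finset.mul_sum, designForm]
        have := hs.1
        gcongr with i
        obtain ⟨k, hk⟩ := hω i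
        exact hk ▸ ciInf_le (Finite.bddBelow_range _) k
    _ ≤ ENNReal.ofReal
          (Real.exp (-((s - s ^ 2 / 2) * (smoothedParam lamA σ S * ‖x‖ ^ 2)))) ^ N u :=
        hdata.lintegral_prod_exp_neg_iInf_inner_sq_le hρ u hx hs
    _ = ENNReal.ofReal (Real.exp
          (-((s - s ^ 2 / 2) * (smoothedParam lamA σ S * N u * ‖x‖ ^ 2)))) := by
        rw [← ENNReal.ofReal_pow (Real.exp_nonneg _), ← Real.exp_nat_mul]
        ring_nf

lemma RewardModel.lintegral_exp_noise_le (hR : RewardModel θ R) (u : ι) {b : Vec d}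
    (hb : ‖b‖ ≤ 1) (y : ℝ) :
    ∫⁻ z, ENNReal.ofReal (Real.exp (y * (z - inner ℝ (θ u) b) - y ^ 2 / 2)) ∂(R u b) ≤ 1 := by
  have hsub := hR.subgaussian u b hb
  calc ∫⁻ z, ENNReal.ofReal (Real.exp (y * (z - inner ℝ (θ u) b) - y ^ 2 / 2)) ∂(R u b)
      = ENNReal.ofReal (∫ z, Real.exp (y * (z - inner ℝ (θ u) b)) ∂(R u b))
          / ENNReal.ofReal (Real.exp (y ^ 2 / 2)) := by
        simp only [Real.exp_sub, ENNReal.ofReal_div_of_pos (Real.exp_pos _)]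
        simp only [div_eq_mul_inv]
        rw [lintegral_mul_const _ (by fun_prop), ofReal_integral_eq_lintegral_ofReal
          (hsub.integrable_exp_mul y) (ae_of_all _ fun z => Real.exp_nonneg _)]
    _ ≤ 1 := by
        refine ENNReal.div_le_of_le_mul ?_
        rw [one_mul]
        exact ENNReal.ofReal_le_ofReal (by simpa [mgf] using hsub.mgf_le y)

lemma IsOfflineData.hasCondDistrib_reward [IsFiniteMeasure P]
    (hdata : IsOfflineData P ρ S R K X a r) (u : ι) [IsFiniteKernel (R u)] (i : Fin (N u))
    {𝓧 : Type*} [MeasurableSpace 𝓧] {W : Ω → 𝓧} (hW : Measurable[history K X a r u i] W) :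
    HasCondDistrib (r u i) (fun ω => (W ω, a u i ω))
      (Kernel.prodMkLeft 𝓧 (R u)) P := by
  have hpast : Measurable[history K X a r u i
      ⊔ (⨆ k, MeasurableSpace.comap (X u i k) inferInstance)
      ⊔ MeasurableSpace.comap (a u i) inferInstance] fun ω => (W ω, a u i ω) :=
    Measurable.prodMk (hW.mono (le_sup_of_le_left le_sup_left) le_rfl)
      (measurable_iff_comap_le.2 le_sup_right)
  exact hasCondDistrib_of_setLIntegral
    ((hW.mono (hdata.history_le u i) le_rfl).prodMk (hdata.measurable_action u i))
    (hdata.measurable_reward u i) fun s t hs ht => hdata.reward_law u i _ (hpast hs) t ht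

lemma IsOfflineData.lintegral_mul_exp_noise_le [IsFiniteMeasure P]
    (hdata : IsOfflineData P ρ S R K X a r) (hρ : ∀ᵐ a ∂ρ, ‖a‖ ≤ 1) (hR : RewardModel θ R)
    (u : ι) (x : Vec d) (i : Fin (N u)) {W : Ω → ℝ≥0∞} (hW : Measurable[history K X a r u i] W) :
    ∫⁻ ω, W ω * ENNReal.ofReal (Real.exp (inner ℝ x (a u i ω)
        * (r u i ω - inner ℝ (θ u) (a u i ω)) - inner ℝ x (a u i ω) ^ 2 / 2)) ∂P
      ≤ ∫⁻ ω, W ω ∂P := by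
  have := hR.isMarkov u
  rw [lintegral_comp_of_hasCondDistrib (hdata.hasCondDistrib_reward u i hW)
    (f := fun q => q.1.1 * ENNReal.ofReal (Real.exp (inner ℝ x q.1.2
        * (q.2 - inner ℝ (θ u) q.1.2) - inner ℝ x q.1.2 ^ 2 / 2))) (by fun_prop)]
  refine lintegral_mono_ae ?_
  filter_upwards [hdata.norm_action_le hρ u] with ω hω
  simp only [Kernel.prodMkLeft_apply]
  rw [lintegral_const_mul _ (by fun_prop)]
  exact mul_le_of_le_one_right' (hR.lintegral_exp_noise_le u (hω i) _)

lemma IsOfflineData.lintegral_exp_noiseVector_le [IsProbabilityMeasure P]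
    (hdata : IsOfflineData P ρ S R K X a r) (hρ : ∀ᵐ a ∂ρ, ‖a‖ ≤ 1) (hR : RewardModel θ R)
    (u : ι) (x : Vec d) :
    ∫⁻ ω, ENNReal.ofReal (Real.exp (inner ℝ x (noiseVector (θ u) (a u · ω) (r u · ω))
      - designForm (a u · ω) x / 2)) ∂P ≤ 1 := by
  have hprod (ω : Ω) : ENNReal.ofReal (Real.exp
        (inner ℝ x (noiseVector (θ u) (a u · ω) (r u · ω)) - designForm (a u · ω) x / 2))
      = ∏ i, ENNReal.ofReal (Real.exp (inner ℝ x (a u i ω)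
          * (r u i ω - inner ℝ (θ u) (a u i ω)) - inner ℝ x (a u i ω) ^ 2 / 2)) := by
    rw [← ENNReal.ofReal_prod_of_nonneg fun _ _ => Real.exp_nonneg _, ← Real.exp_sum,
      Finset.sum_sub_distrib, ← Finset.sum_div, noiseVector, designForm, inner_sum]
    simp only [real_inner_smul_right, mul_comm]
  simp only [hprod]
  refine (lintegral_prod_le_of_forall_weight (history K X a r u) _ 1 (fun i j hji => ?_)
    fun i W hW => ?_).trans_eq (by simp)
  · have haction : Measurable[history K X a r u i] (a u j) := measurable_action_history hji
    have hreward : Measurable[history K X a r u i] (r u j) := measurable_reward_history hji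
    fun_prop
  · rw [Pi.one_apply, one_mul]
    exact hdata.lintegral_mul_exp_noise_le hρ hR u x i hW

end OfflineData

section ConfidenceWidth

variable {Ω : Type*} [MeasurableSpace Ω] {P : Measure Ω} [IsProbabilityMeasure P]
  {ι : Type*} {N : ι → ℕ} {d : ℕ} {ρ : Measure (Vec d)} {lamA σ : ℝ} {S : ℕ} {θ : ι → Vec d}
  {R : ι → Kernel (Vec d) ℝ} {K : (u : ι) → Fin (N u) → ℕ}
  {X : (u : ι) → (i : Fin (N u)) → Fin (K u i) → Ω → Vec d}
  {a : (u : ι) → Fin (N u) → Ω → Vec d} {r : (u : ι) → Fin (N u) → Ω → ℝ}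

lemma IsOfflineData.measure_exists_designForm_le (hdata : IsOfflineData P ρ S R K X a r)
    (hρ : ActionRegularity ρ lamA σ) (hd : 0 < d) (u : ι) {w : ℝ}
    (hw : w ∈ Set.Ioc (0 : ℝ) (1 / 2))
    (hn : 16 / smoothedParam lamA σ S ^ 2 * Real.log (4 * d / (smoothedParam lamA σ S ^ 2 * w))
      ≤ N u) :
    P {ω | ∃ x : Vec d, ‖x‖ = 1 ∧
        designForm (a u · ω) x ≤ smoothedParam lamA σ S * N u / 2} ≤ ENNReal.ofReal w := by
  have : NeZero d := ⟨hd.ne'⟩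
  have ht := smoothedParam_pos (S := S) hρ.lamA_pos hρ.σ_pos
  have hdt : d * smoothedParam lamA σ S ≤ 1 :=
    (mul_le_mul_of_nonneg_left (smoothedParam_le hρ.lamA_pos.le) d.cast_nonneg).trans
      hρ.dim_mul_lamA_le_one
  simpa using OffClusBand.measure_exists_designForm_le (hdata.measurable_action u)
    (hdata.norm_action_le hρ.norm_le_one u) ht (by simpa using hdt)
    (fun x hx => (hdata.lintegral_exp_neg_designForm_le hρ u hx (s := 2 / 5)
      ⟨by norm_num, by norm_num⟩).trans_eq (by norm_num)) hw (by simpa using hn)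

lemma IsOfflineData.measure_exists_noiseVector_lt (hdata : IsOfflineData P ρ S R K X a r)
    (hρ : ∀ᵐ a ∂ρ, ‖a‖ ≤ 1) (hR : RewardModel θ R) (hd : 0 < d) (u : ι) {lam ε : ℝ}
    (hlam : 0 < lam) (hε : 0 < ε) :
    P {ω | ∃ w : Vec d, d * Real.log (1 + N u / (lam * d)) + 2 * Real.log (1 / ε)
          + (lam * ‖w‖ ^ 2 + designForm (a u · ω) w)
        < 2 * inner ℝ w (noiseVector (θ u) (a u · ω) (r u · ω))} ≤ ENNReal.ofReal ε := by
  have : NeZero d := ⟨hd.ne'⟩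
  have haction := hdata.measurable_action u
  have hreward := hdata.measurable_reward u
  simpa using measure_exists_selfNormalized_lt haction (hdata.norm_action_le hρ u)
    (s := fun ω => noiseVector (θ u) (a u · ω) (r u · ω))
    (by simp only [noiseVector]; fun_prop) (hdata.lintegral_exp_noiseVector_le hρ hR u) hlam hε

lemma IsOfflineData.measure_ciWidth_lt_norm_ridge_sub_le (hdata : IsOfflineData P ρ S R K X a r)
    (hρ : ActionRegularity ρ lamA σ) (hR : RewardModel θ R) (hd : 0 < d) {u : ι}
    (hN : 0 < N u) (hθ : ‖θ u‖ ≤ 1) {p : Params} (hlamT : p.lamT = smoothedParam lamA σ S)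
    (hlam : 0 < p.lam) (hδ : p.δ ∈ Set.Ioc (0 : ℝ) 1) {U : ℕ} (hU : 0 < U)
    (hn : nMin p U d ≤ N u) :
    P {ω | ciWidth p U d (N u) < ‖ridge p.lam (fun u i => (a u i ω, r u i ω)) u - θ u‖}
      ≤ ENNReal.ofReal (p.δ / U) := by
  have hU₁ : (1 : ℝ) ≤ U := by exact_mod_cast hU
  have hδ₀ := hδ.1
  set ε : ℝ := p.δ / (2 * U) with hε_def
  have hε : ε ∈ Set.Ioc (0 : ℝ) (1 / 2) :=
    ⟨by positivity, by rw [hε_def, div_le_div_iff₀ (by positivity) two_pos]; linarith [hδ.2]⟩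
  have ht : 0 < p.lamT := hlamT ▸ smoothedParam_pos hρ.lamA_pos hρ.σ_pos
  have hnMin : nMin p U d = 16 / p.lamT ^ 2 * Real.log (4 * d / (p.lamT ^ 2 * ε)) := by
    rw [nMin, hε_def]
    congr 2
    field_simp
    ring
  rw [hnMin, hlamT] at hn
  have hunexplored := hdata.measure_exists_designForm_le hρ hd u hε hn
  have hnoisy := hdata.measure_exists_noiseVector_lt hρ.norm_le_one hR hd u hlam hε.1
  rw [hε_def, one_div_div, ← hε_def] at hnoisy
  rw [← hlamT] at hunexplored
  refine (measure_mono fun ω hω => ?_).trans ((measure_union_le _ _).trans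
    ((add_le_add hunexplored hnoisy).trans_eq ?_))
  · by_contra! hgood
    simp only [Set.mem_union, Set.mem_ofPred_eq, not_or, not_exists, not_and, not_le, not_lt]
      at hgood
    exact (norm_ridge_sub_le hlam (fun u i => (a u i ω, r u i ω)) u hθ (by positivity)
      (fun x hx => (hgood.1 x hx).le) hgood.2).not_gt hω
  · rw [← ENNReal.ofReal_add hε.1.le hε.1.le, hε_def]
    congr 1
    field_simp
    ring

end ConfidenceWidth

section Policy

variable {ι : Type*} {N : ι → ℕ} {d : ℕ}

lemma ciWidth_nonneg (p : Params) (U d n : ℕ) : 0 ≤ ciWidth p U d n := by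
  unfold ciWidth
  positivity

lemma confidence_radicand_le {p : Params} {U d n : ℕ} (hlam : 0 ≤ p.lam) (hδ : 0 < p.δ)
    (hδ_le : p.δ ≤ 2 * U / (1 + n / (p.lam * d))) :
    d * Real.log (1 + n / (p.lam * d)) + 2 * Real.log (2 * U / p.δ)
      ≤ 2 * (Real.log (2 * U / p.δ) * max 2 (d : ℝ)) := by
  have hlog : Real.log (1 + n / (p.lam * d)) ≤ Real.log (2 * U / p.δ) := by
    refine Real.log_le_log (by positivity) ?_
    rwa [le_div_comm₀ (by positivity) hδ]
  have hlog_nonneg : 0 ≤ Real.log (1 + n / (p.lam * d)) :=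
    Real.log_nonneg (le_add_of_nonneg_right (by positivity))
  have := hlog_nonneg.trans hlog
  calc d * Real.log (1 + n / (p.lam * d)) + 2 * Real.log (2 * U / p.δ)
      ≤ max 2 (d : ℝ) * Real.log (2 * U / p.δ) + max 2 (d : ℝ) * Real.log (2 * U / p.δ) := by
        gcongr
        exacts [le_max_right _ _, le_max_left _ _]
    _ = 2 * (Real.log (2 * U / p.δ) * max 2 (d : ℝ)) := by ring

lemma ciWidth_le {p : Params} {U d n : ℕ} (hlam : 0 ≤ p.lam) (hδ : 0 < p.δ) (ht : 0 ≤ p.lamT)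
    (hlam_le : p.lam ≤ d * Real.log (1 + n / (p.lam * d)) + 2 * Real.log (2 * U / p.δ))
    (hδ_le : p.δ ≤ 2 * U / (1 + n / (p.lam * d))) :
    ciWidth p U d n
      ≤ 4 * √(Real.log (2 * U / p.δ) * max 2 (d : ℝ)) / √p.lamT * (1 / √(n : ℝ)) := by
  have hradicand := confidence_radicand_le hlam hδ hδ_le
  set A : ℝ := d * Real.log (1 + n / (p.lam * d)) + 2 * Real.log (2 * U / p.δ)
  set B : ℝ := Real.log (2 * U / p.δ) * max 2 (d : ℝ)
  calc ciWidth p U d n = (√A + √p.lam) / √(p.lamT * n / 2) := rfl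
    _ ≤ (√(2 * B) + √(2 * B)) / √(p.lamT * n / 2) := by
        gcongr
        exact hlam_le.trans hradicand
    _ = 2 * (√2 * √2) * √B / (√p.lamT * √(n : ℝ)) := by
        rw [Real.sqrt_div (by positivity), Real.sqrt_mul ht, Real.sqrt_mul zero_le_two,
          div_div_eq_mul_div]
        ring
    _ = 4 * √B / √p.lamT * (1 / √(n : ℝ)) := by
        rw [Real.mul_self_sqrt zero_le_two]
        ring

variable [Fintype ι]

lemma lowerGap_nonpos_of_adj {p : Params} (hα : 0 ≤ p.α) {D : Dataset ι N d} {u v : ι}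
    (huv : (connGraph p D (underestimate p D u)).Adj u v) : lowerGap p D u v ≤ 0 := by
  obtain ⟨hne, hlt, -⟩ := huv
  by_contra! hpos
  have hmem : v ∈ separatedUsers p D u := by simp [separatedUsers, hne.symm, hpos]
  have hle : underestimate p D u ≤ lowerGap p D u v := by
    rw [underestimate, dif_pos ⟨v, hmem⟩]
    exact Finset.inf'_le _ hmem
  have hwidth : 0 ≤ p.α * (ciWidth p (Fintype.card ι) d (N u)
      + ciWidth p (Fintype.card ι) d (N v)) :=
    mul_nonneg hα (add_nonneg (ciWidth_nonneg ..) (ciWidth_nonneg ..))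
  rw [lowerGap] at hle
  linarith

lemma norm_sub_le_of_adj {p : Params} (hα : 0 ≤ p.α) {θ : ι → Vec d} {D : Dataset ι N d}
    (hvalid : ∀ u, nMin p (Fintype.card ι) d ≤ N u →
      ‖ridge p.lam D u - θ u‖ ≤ ciWidth p (Fintype.card ι) d (N u)) {u v : ι}
    (huv : (connGraph p D (underestimate p D u)).Adj u v) :
    ‖θ u - θ v‖ ≤ (p.α + 1)
      * (ciWidth p (Fintype.card ι) d (N u) + ciWidth p (Fintype.card ι) d (N v)) := by
  have hgap := lowerGap_nonpos_of_adj hα huv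
  rw [lowerGap] at hgap
  have hu := hvalid u (huv.2.2.trans (min_le_left _ _))
  have hv := hvalid v (huv.2.2.trans (min_le_right _ _))
  calc ‖θ u - θ v‖ = dist (θ u) (θ v) := (dist_eq_norm _ _).symm
    _ ≤ dist (θ u) (ridge p.lam D u) + dist (ridge p.lam D u) (ridge p.lam D v)
        + dist (ridge p.lam D v) (θ v) := dist_triangle4 _ _ _ _
    _ = ‖ridge p.lam D u - θ u‖ + ‖ridge p.lam D u - ridge p.lam D v‖
        + ‖ridge p.lam D v - θ v‖ := by
        rw [dist_comm (θ u), dist_eq_norm, dist_eq_norm, dist_eq_norm]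
    _ ≤ _ := by linarith

lemma mul_norm_sub_le_of_mem_heteroNeighbors {p : Params} (hα : 0 ≤ p.α) (hlam : 0 ≤ p.lam)
    (hδ : 0 < p.δ) (ht : 0 ≤ p.lamT)
    (hlam_le : ∀ u, p.lam ≤ d * Real.log (1 + N u / (p.lam * d))
      + 2 * Real.log (2 * Fintype.card ι / p.δ))
    (hδ_le : ∀ u, p.δ ≤ 2 * Fintype.card ι / (1 + N u / (p.lam * d)))
    {θ : ι → Vec d} {D : Dataset ι N d}
    (hvalid : ∀ u, nMin p (Fintype.card ι) d ≤ N u →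
      ‖ridge p.lam D u - θ u‖ ≤ ciWidth p (Fintype.card ι) d (N u)) {u v : ι}
    (hv : v ∈ heteroNeighbors θ p D (underestimate p D u) u) :
    √p.lamT / (4 * (p.α + 1) * √(Real.log (2 * Fintype.card ι / p.δ) * max 2 (d : ℝ)))
        * ‖θ u - θ v‖ ≤ 1 / √(N u : ℝ) + 1 / √(N v : ℝ) := by
  have hadj : (connGraph p D (underestimate p D u)).Adj u v :=
    hv.1.resolve_left fun h => hv.2 (congrArg θ h).symm
  set B : ℝ := √(Real.log (2 * Fintype.card ι / p.δ) * max 2 (d : ℝ))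
  set αw : ℝ := √p.lamT / (4 * (p.α + 1) * B) with hαw
  set z : ℝ := 1 / √(N u : ℝ) + 1 / √(N v : ℝ) with hz
  have hnorm : ‖θ u - θ v‖ ≤ αw⁻¹ * z :=
    calc ‖θ u - θ v‖ ≤ (p.α + 1)
          * (ciWidth p (Fintype.card ι) d (N u) + ciWidth p (Fintype.card ι) d (N v)) :=
        norm_sub_le_of_adj hα hvalid hadj
      _ ≤ (p.α + 1) * (4 * B / √p.lamT * (1 / √(N u : ℝ))
          + 4 * B / √p.lamT * (1 / √(N v : ℝ))) := by
        gcongr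
        · exact ciWidth_le hlam hδ ht (hlam_le u) (hδ_le u)
        · exact ciWidth_le hlam hδ ht (hlam_le v) (hδ_le v)
      _ = αw⁻¹ * z := by
        rw [hαw, hz, inv_div]
        ring
  calc αw * ‖θ u - θ v‖ ≤ αw * (αw⁻¹ * z) := by gcongr
    _ = αw * αw⁻¹ * z := (mul_assoc _ _ _).symm
    _ ≤ z := mul_le_of_le_one_left (by positivity) mul_inv_le_one

end Policy

end OffClusBand

open OffClusBand in
theorem mainTheorem7_general
    {Ω : Type*} [MeasurableSpace Ω] (P : Measure Ω) [IsProbabilityMeasure P]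
    {ι : Type*} [Fintype ι] (d : ℕ) (hd : 0 < d)
    (N : ι → ℕ) (hN : ∀ u, 0 < N u)
    (θ : ι → Vec d) (hθ : ∀ u, ‖θ u‖ ≤ 1)
    (ρ : Measure (Vec d)) (lamA σ : ℝ)
    (hρ : ActionRegularity ρ lamA σ) (S : ℕ)
    (R : ι → Kernel (Vec d) ℝ) (hR : RewardModel θ R)
    (K : (u : ι) → Fin (N u) → ℕ)
    (X : (u : ι) → (i : Fin (N u)) → Fin (K u i) → Ω → Vec d)
    (a : (u : ι) → Fin (N u) → Ω → Vec d) (r : (u : ι) → Fin (N u) → Ω → ℝ)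
    (hdata : IsOfflineData P ρ S R K X a r)
    (p : Params) (hlamT : p.lamT = smoothedParam lamA σ S)
    (hα : 0 ≤ p.α) (hlam : 0 < p.lam) (hδ : p.δ ∈ Set.Ioo (0 : ℝ) 1)
    (hlam_le : ∀ u, p.lam ≤ d * Real.log (1 + N u / (p.lam * d))
      + 2 * Real.log (2 * Fintype.card ι / p.δ))
    (hδ_le : ∀ u, p.δ ≤ 2 * Fintype.card ι / (1 + N u / (p.lam * d))) :
    ENNReal.ofReal (1 - p.δ) ≤ P {ω | ∀ u,
      let D : Dataset ι N d := fun u i => (a u i ω, r u i ω)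
      let γhat : ℝ := underestimate p D u
      let αw : ℝ := √p.lamT
        / (4 * (p.α + 1) * √(Real.log (2 * Fintype.card ι / p.δ) * max 2 (d : ℝ)))
      ∀ v ∈ heteroNeighbors θ p D γhat u,
        1 / √(N u : ℝ) + 1 / √(N v : ℝ) ≥ αw * ‖θ u - θ v‖} := by
  have ht : 0 < p.lamT := hlamT ▸ smoothedParam_pos hρ.lamA_pos hρ.σ_pos
  refine ofReal_one_sub_le_of_compl_subset_iUnion hδ.1.le
    (B := fun u => {ω | nMin p (Fintype.card ι) d ≤ N u ∧ ciWidth p (Fintype.card ι) d (N u)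
      < ‖ridge p.lam (fun u i => (a u i ω, r u i ω)) u - θ u‖}) (fun u => ?_) fun ω hω => ?_
  · by_cases hn : nMin p (Fintype.card ι) d ≤ N u
    · exact (measure_mono fun ω hω => hω.2).trans
        (hdata.measure_ciWidth_lt_norm_ridge_sub_le hρ hR hd (hN u) (hθ u) hlamT hlam
          (Set.Ioo_subset_Ioc_self hδ) (Fintype.card_pos_iff.2 ⟨u⟩) hn)
    · simp [hn]
  · by_contra hvalid
    simp only [Set.mem_iUnion, Set.mem_ofPred_eq, not_exists, not_and, not_lt] at hvalid
    exact hω fun u v hv =>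
      mul_norm_sub_le_of_mem_heteroNeighbors hα hlam.le hδ.1 ht.le hlam_le hδ_le hvalid hv

theorem mainTheorem7
    {Ω : Type*} [MeasurableSpace Ω] (P : Measure Ω) [IsProbabilityMeasure P]
    {ι : Type*} [Fintype ι] (d : ℕ) (hd : 0 < d)
    (N : ι → ℕ) (hN : ∀ u, 0 < N u)
    (θ : ι → OffClusBand.Vec d) (hθ : ∀ u, ‖θ u‖ ≤ 1)
    (ρ : Measure (OffClusBand.Vec d)) (lamA σ : ℝ)
    (hρ : OffClusBand.ActionRegularity ρ lamA σ) (S : ℕ)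
    (R : ι → Kernel (OffClusBand.Vec d) ℝ) (hR : OffClusBand.RewardModel θ R)
    (K : (u : ι) → Fin (N u) → ℕ)
    (X : (u : ι) → (i : Fin (N u)) → Fin (K u i) → Ω → OffClusBand.Vec d)
    (a : (u : ι) → Fin (N u) → Ω → OffClusBand.Vec d) (r : (u : ι) → Fin (N u) → Ω → ℝ)
    (hdata : OffClusBand.IsOfflineData P ρ S R K X a r)
    (p : OffClusBand.Params) (hlamT : p.lamT = OffClusBand.smoothedParam lamA σ S)
    (hα : 1 ≤ p.α) (hlam : 0 < p.lam) (hδ : p.δ ∈ Set.Ioo (0 : ℝ) 1)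
    (hlam_le : ∀ u, p.lam ≤ d * Real.log (1 + N u / (p.lam * d))
      + 2 * Real.log (2 * Fintype.card ι / p.δ))
    (hδ_le : ∀ u, p.δ ≤ 2 * Fintype.card ι / (1 + N u / (p.lam * d)))
    (uTest : ι) :
    ENNReal.ofReal (1 - p.δ) ≤ P {ω |
      let D : OffClusBand.Dataset ι N d := fun u i => (a u i ω, r u i ω)
      let γhat : ℝ := OffClusBand.underestimate p D uTest
      let αw : ℝ := √p.lamT
        / (4 * (p.α + 1) * √(Real.log (2 * Fintype.card ι / p.δ) * max 2 (d : ℝ)))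
      ∀ v ∈ OffClusBand.heteroNeighbors θ p D γhat uTest,
        1 / √(N uTest : ℝ) + 1 / √(N v : ℝ) ≥ αw * ‖θ uTest - θ v‖} :=
  (mainTheorem7_general P d hd N hN θ hθ ρ lamA σ hρ S R hR K X a r hdata p hlamT
    (zero_le_one.trans hα) hlam hδ hlam_le hδ_le).trans (measure_mono fun _ hω => hω uTest)
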